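/- A \emph{juggling state} is a finite vector $\langle s_1,\dots,s_h\rangle$ of nonnegative integers, where trailing zeros are irrelevant. A \emph{juggling sequence} of length $n$ from $\mathbf a$ to $\mathbf b$ is a sequence $(\mathbf s_0,\dots,\mathbf s_n)$ of states with $\mathbf s_0=\mathbf a$, $\mathbf s_n=\mathbf b$ such that for each $i$, writing $\mathbf s_{i-1}=\langle s_1,s_2,\dots\rangle$, one has $\mathbf s_i=\langle s_2+b_1,s_3+b_2,\dots\rangle$ for some finitely supported nonnegative integers $b_1,b_2,\dots$ with $\sum_j b_j=s_1$. Let $\mathsf{js}(\mathbf a,\mathbf b,n)$ be the number of these sequences, and let $\mathrm{RJS}(\mathbf a,\mathbf b,n)$ be the set of sequences defined in the same way with nonnegative real numbers in place of nonnegative integers. For $\mu\in\mathbb R^{r+1}$, the \emph{flow polytope} $\mathcal F_{A_r}(\mu)$ is the set of functions $f\colon\Phi^+\to\mathbb R_{\ge 0}$ on $\Phi^+=\{\varepsilon_i-\varepsilon_j:1\le i<j\le r+1\}$ with $\sum_{\beta\in\Phi^+}f(\beta)\beta=\mu$. Let $\mu_1,\dots,\mu_r$ be natural numbers (nonnegative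 integers) and put $$P=\mathrm{RJS}(\langle\mu_1,\dots,\mu_r\rangle,\langle\mu_1+\cdots+\mu_r\rangle,r),\qquad F=\mathcal F_{A_r}\bigl(\mu_1,\dots,\mu_r,-(\mu_1+\cdots+\mu_r)\bigr).$$ (a) The numbers $\mathsf{js}(\langle t\mu_1,\dots,t\mu_r\rangle,\langle t(\mu_1+\cdots+\mu_r)\rangle,r)$, for positive integers $t$, are finite and are the values $p(t)$ of a polynomial $p$ with rational coefficients. Its degree is the dimension of the juggling polytope $P$, and its leading coefficient is the relative volume of $P$, that is, the volume in the affine span of $P$, normalized so that a fundamental parallelepiped of the lattice of integral points of this affine span has volume $1$. (b) $P$ and $F$ are convex polytopes, and $F$ is integrally equivalent to $P$: there is an affine map that restricts to a bijection $F\to P$ and to a bijection from the integral points of the affine span of $F$ to those of the affine span of $P$. (c) All vertices of $F$ and all vertices of $P$ are integral. -/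

import Mathlib

noncomputable section

namespace Juggling

/-! ### Juggling states and juggling sequences -/

/-- The state `⟨μ₁, …, μ_r⟩`. A state is a finitely supported function of the height, so that
vectors which differ by trailing zeros are the same state; the entry at index `j : ℕ` is the one at
height `j + 1`. -/
def state {R : Type*} [AddCommMonoid R] {r : ℕ} (μ : Fin r → R) : ℕ →₀ R :=
  ∑ i : Fin r, Finsupp.single (i : ℕ) (μ i)

/-- The state `s'` may follow the state `s`: every entry at height at least 2 descends by one, and
the entry of `s` at height 1 is redistributed, `b j ≥ 0` of it being thrown to height `j + 1`. -/
def Succeeds {R : Type*} [AddCommMonoid R] [PartialOrder R] (s s' : ℕ →₀ R) : Prop :=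
  ∃ b : ℕ →₀ R, (∀ j, 0 ≤ b j) ∧ (b.sum fun _ x => x) = s 0 ∧ ∀ j, s' j = s (j + 1) + b j

/-- The sequences `(s₀, …, s_n)` of states with nonnegative entries in `R`, with initial state `a`
and terminal state `b`, without hand capacity constraint, in which each state is followed by a
state that may succeed it. -/
def sequences (R : Type*) [AddCommMonoid R] [PartialOrder R] (a b : ℕ →₀ R) (n : ℕ) :
    Set (Fin (n + 1) → ℕ →₀ R) :=
  {S | (∀ i j, 0 ≤ S i j) ∧ S 0 = a ∧ S (Fin.last n) = b ∧
    ∀ i : Fin n, Succeeds (S i.castSucc) (S i.succ)}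

/-- The set of (multiplex) juggling sequences. -/
def JS (a b : ℕ →₀ ℕ) (n : ℕ) : Set (Fin (n + 1) → ℕ →₀ ℕ) := sequences ℕ a b n

/-- The number of juggling sequences. -/
def js (a b : ℕ →₀ ℕ) (n : ℕ) : ℕ := (JS a b n).ncard

/-- The set of real-valued juggling sequences. -/
def RJS (a b : ℕ →₀ ℝ) (n : ℕ) : Set (Fin (n + 1) → ℕ →₀ ℝ) := sequences ℝ a b n

/-- The integral points of the space in which `RJS a b n` lies. -/
def integralSequences (n : ℕ) : Set (Fin (n + 1) → ℕ →₀ ℝ) :=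
  {S | ∀ i j, ∃ z : ℤ, S i j = z}

/-! ### Flow polytopes of type `A` -/

/-- The positive roots `ε_i - ε_j`, `i < j`, of type `A_r`, each given by its pair `(i, j)`. -/
abbrev PosRoot (r : ℕ) : Type := {p : Fin (r + 1) × Fin (r + 1) // p.1 < p.2}

/-- The vector `ε_i - ε_j` of a positive root. -/
def PosRoot.vec {r : ℕ} (β : PosRoot r) : Fin (r + 1) → ℝ :=
  Pi.single β.1.1 1 - Pi.single β.1.2 1

/-- The type `A_r` flows with netflow `μ`. -/
def flowPolytope (r : ℕ) (μ : Fin (r + 1) → ℝ) : Set (PosRoot r → ℝ) :=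
  {f | (∀ β, 0 ≤ f β) ∧ ∑ β : PosRoot r, f β • PosRoot.vec β = μ}

/-- The points of `ℝ^ι` with integral coordinates. -/
def integralPoints (ι : Type*) : Set (ι → ℝ) :=
  {f | ∀ i, ∃ z : ℤ, f i = z}

/-- The weight `⟨μ₁, …, μ_r, -(μ₁ + ⋯ + μ_r)⟩` of type `A_r`. -/
def weight {r : ℕ} (μ : Fin r → ℝ) : Fin (r + 1) → ℝ :=
  Fin.snoc (α := fun _ => ℝ) μ (-∑ i, μ i)

/-! ### Polytopes and lattices -/

section Polytopes

variable {V W : Type*} [AddCommGroup V] [Module ℝ V] [AddCommGroup W] [Module ℝ W]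

/-- A convex polytope: the convex hull of finitely many points. -/
def IsPolytope (P : Set V) : Prop :=
  ∃ F : Set V, F.Finite ∧ P = convexHull ℝ F

/-- The dimension of a polytope is the dimension of its affine span. -/
def polytopeDim (P : Set V) : ℕ :=
  Module.finrank ℝ (affineSpan ℝ P).direction

/-- `P` and `Q`, in spaces with sets `L` and `M` of integral points, are integrally equivalent: some
affine map restricts to a bijection of `P` onto `Q`, and to a bijection of the integral points of
the affine span of `P` onto those of the affine span of `Q`. -/
def IntegrallyEquivalent (L : Set V) (P : Set V) (M : Set W) (Q : Set W) : Prop :=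
  ∃ φ : V →ᵃ[ℝ] W, Set.BijOn φ P Q ∧
    Set.BijOn φ (L ∩ affineSpan ℝ P) (M ∩ affineSpan ℝ Q)

/-- An affine isomorphism of `ℝ^d` onto the affine span of `P` that carries the integral points of
`ℝ^d` onto the points of `L` in this affine span. -/
def IsLatticeChart (L : Set V) (P : Set V) {d : ℕ} (φ : (Fin d → ℝ) →ᵃ[ℝ] V) : Prop :=
  Function.Injective φ ∧ Set.range φ = affineSpan ℝ P ∧
    φ '' integralPoints (Fin d) = L ∩ affineSpan ℝ P

/-- `P` has relative volume `v` with respect to the lattice of the points of `L` in the affine span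
of `P`. Relative volume is Lebesgue measure on the affine span, normalized so that a fundamental
parallelepiped of this lattice has volume 1; that is, it is the Lebesgue measure of the preimage
of `P` under any lattice chart. That there is a lattice chart, and that all of them give the same
value, is part of the definition. -/
def HasRelativeVolume (L : Set V) (P : Set V) (v : ENNReal) : Prop :=
  (∃ (d : ℕ) (φ : (Fin d → ℝ) →ᵃ[ℝ] V), IsLatticeChart L P φ) ∧
    ∀ (d : ℕ) (φ : (Fin d → ℝ) →ᵃ[ℝ] V), IsLatticeChart L P φ →
      MeasureTheory.volume (φ ⁻¹' P) = v

end Polytopes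

/-- The juggling polytope `RJS(⟨μ₁, …, μ_r⟩, ⟨μ₁ + ⋯ + μ_r⟩, r)`. -/
def jugglingPolytope {r : ℕ} (μ : Fin r → ℝ) : Set (Fin (r + 1) → ℕ →₀ ℝ) :=
  RJS (state μ) (state ![∑ i, μ i]) r

end Juggling

end

noncomputable section

namespace Juggling

open Finset

/-! ### Netflow conditions -/

/-! Record a juggling sequence by its throws. If `f (ε_i - ε_j)` is the mass thrown at time `i` to
land at time `j`, the entry at height one at time `i` is `μ i` plus the inflow at `i`, and "all of
it is rethrown" is the netflow equation at `i`. Thus `flowToSequence` is an injective affine map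
carrying F onto P. Its left inverse `sequenceToFlow` takes differences of entries, so both
directions preserve integrality, and everything about P can be read off from F.

Vertices. A vertex of F has no nonzero circulation in its support. Two edges of positive flow out of
one vertex could each be continued to the sink, and the difference of the two paths would be such a
circulation. So each vertex of the graph emits along at most one edge, and the values are integral
by induction along the graph. F is compact, so Krein–Milman makes it the hull of its extreme points,
which are finite in number because they are integral and bounded.

Counting. The edges into the sink are determined by the other (inner) edges, leaving the condition
that the outflow of each vertex is at most its supply plus its inflow. If the inner edges are served
in order of their tails, each one moves some number `x` of units, at most what its tail then holds.
Summing out one edge at a time with Faulhaber's formula shows that the count is one polynomial in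
the supply (`exists_mvPolynomial_ncard_coveredFlows`); it is then restricted to the ray `t ↦ t μ`.

Degree and leading coefficient. Let `k` be the first index with `μ k ≠ 0`. All flow out of earlier
vertices vanishes, and the inner edges with tail at least `k` are lattice coordinates on the affine
span in which the polytope has interior. Dividing the count by `t ^ d` gives the volume in the
limit, which is positive and finite; this fixes the degree and the leading coefficient. -/

/-- The total flow out of the vertex `i`. -/
def outflow {r : ℕ} (f : PosRoot r → ℝ) (i : Fin (r + 1)) : ℝ :=
  ∑ β : PosRoot r, if β.1.1 = i then f β else 0

/-- The total flow into the vertex `i`. -/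
def inflow {r : ℕ} (f : PosRoot r → ℝ) (i : Fin (r + 1)) : ℝ :=
  ∑ β : PosRoot r, if β.1.2 = i then f β else 0

theorem sum_smul_vec_apply {r : ℕ} (f : PosRoot r → ℝ) (i : Fin (r + 1)) :
    (∑ β : PosRoot r, f β • PosRoot.vec β) i = outflow f i - inflow f i := by
  simp only [Finset.sum_apply, outflow, inflow, ← Finset.sum_sub_distrib]
  refine Finset.sum_congr rfl fun β _ => ?_
  simp only [PosRoot.vec, Pi.smul_apply, Pi.sub_apply, Pi.single_apply, smul_eq_mul, eq_comm (a := i)]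
  split_ifs <;> simp

theorem mem_flowPolytope_iff {r : ℕ} {w : Fin (r + 1) → ℝ} {f : PosRoot r → ℝ} :
    f ∈ flowPolytope r w ↔ (∀ β, 0 ≤ f β) ∧ ∀ i, outflow f i - inflow f i = w i := by
  simp only [flowPolytope, Set.mem_ofPred_eq, funext_iff, sum_smul_vec_apply]

theorem sum_outflow {r : ℕ} (f : PosRoot r → ℝ) : ∑ i, outflow f i = ∑ β, f β := by
  simp only [outflow]
  rw [Finset.sum_comm]
  simp

theorem sum_inflow {r : ℕ} (f : PosRoot r → ℝ) : ∑ i, inflow f i = ∑ β, f β := by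
  simp only [inflow]
  rw [Finset.sum_comm]
  simp

theorem outflow_last {r : ℕ} (f : PosRoot r → ℝ) : outflow f (Fin.last r) = 0 := by
  refine Finset.sum_eq_zero fun β _ => if_neg fun h => ?_
  have := β.2
  rw [h] at this
  exact absurd this (Fin.le_last _).not_gt

@[simp] theorem weight_castSucc {r : ℕ} (μ : Fin r → ℝ) (i : Fin r) :
    weight μ i.castSucc = μ i := by simp [weight]

@[simp] theorem weight_last {r : ℕ} (μ : Fin r → ℝ) :
    weight μ (Fin.last r) = -∑ i, μ i := by simp [weight]

theorem sum_weight {r : ℕ} (μ : Fin r → ℝ) : ∑ i, weight μ i = 0 := by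
  simp [Fin.sum_univ_castSucc]

/-! ### Juggling sequences from flows -/

@[simp] theorem state_apply {R : Type*} [AddCommMonoid R] {r : ℕ} (μ : Fin r → R) (j : ℕ) :
    state μ j = ∑ m : Fin r, if (m : ℕ) = j then μ m else 0 := by
  simp [state, Finsupp.finsetSum_apply, Finsupp.single_apply]

/-- The linear part of `flowToSequence`. -/
def flowToSequenceLinear (r : ℕ) : (PosRoot r → ℝ) →ₗ[ℝ] (Fin (r + 1) → ℕ →₀ ℝ) :=
  ∑ β : PosRoot r, (LinearMap.proj β).smulRight
    (fun i => if β.1.1 < i ∧ i ≤ β.1.2 then Finsupp.single ((β.1.2 : ℕ) - i) (1 : ℝ) else 0)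

/-- The juggling sequence in which the flow on `ε_i - ε_j` is the mass thrown at time `i` that lands
at time `j`. -/
def flowToSequence {r : ℕ} (μ : Fin r → ℝ) : (PosRoot r → ℝ) →ᵃ[ℝ] (Fin (r + 1) → ℕ →₀ ℝ) :=
  (flowToSequenceLinear r).toAffineMap +
    AffineMap.const ℝ (PosRoot r → ℝ) (fun i : Fin (r + 1) => ∑ m : Fin r,
      if (i : ℕ) ≤ m then Finsupp.single ((m : ℕ) - i) (μ m) else 0)

/-- In terms of absolute landing times no subtraction occurs: the guards in the definition exclude
exactly the cases where the natural difference would be truncated. -/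
theorem flowToSequence_apply {r : ℕ} (μ : Fin r → ℝ) (f : PosRoot r → ℝ) (i : Fin (r + 1)) (j : ℕ) :
    flowToSequence μ f i j =
      (∑ β : PosRoot r, if β.1.1 < i ∧ (β.1.2 : ℕ) = i + j then f β else 0) +
        ∑ m : Fin r, if (m : ℕ) = i + j then μ m else 0 := by
  have h1 : flowToSequence μ f i j = (flowToSequenceLinear r f) i j +
      (∑ m : Fin r, if (i : ℕ) ≤ m then Finsupp.single ((m : ℕ) - i) (μ m) else 0 : ℕ →₀ ℝ) j := rfl
  rw [h1]
  congr 1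
  · simp only [flowToSequenceLinear, LinearMap.sum_apply, LinearMap.smulRight_apply,
      LinearMap.proj_apply, Finset.sum_apply, Pi.smul_apply, Finsupp.finsetSum_apply,
      Finsupp.smul_apply, smul_eq_mul]
    refine Finset.sum_congr rfl fun β _ => ?_
    simp only [Fin.le_def]
    split_ifs with h h' h'
    · rw [Finsupp.single_apply, if_pos (by omega), mul_one]
    · rw [Finsupp.single_apply, if_neg (fun h2 => h' ⟨h.1, by omega⟩), mul_zero]
    · exact absurd ⟨h'.1, by omega⟩ h
    · simp
  · rw [Finsupp.finsetSum_apply]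
    refine Finset.sum_congr rfl fun m _ => ?_
    split_ifs with h h' h'
    · rw [Finsupp.single_apply, if_pos (by omega)]
    · rw [Finsupp.single_apply, if_neg (by omega)]
    · omega
    · simp

/-- The throws at time `i` of the juggling sequence of a flow. -/
def throws {r : ℕ} (f : PosRoot r → ℝ) (i : Fin r) : ℕ →₀ ℝ :=
  ∑ β : PosRoot r, if β.1.1 = i.castSucc then Finsupp.single ((β.1.2 : ℕ) - i - 1) (f β) else 0

theorem throws_apply {r : ℕ} (f : PosRoot r → ℝ) (i : Fin r) (j : ℕ) :
    throws f i j =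
      ∑ β : PosRoot r, if β.1.1 = i.castSucc ∧ (β.1.2 : ℕ) = i + 1 + j then f β else 0 := by
  rw [throws, Finsupp.finsetSum_apply]
  refine Finset.sum_congr rfl fun β _ => ?_
  have := β.2
  by_cases h : β.1.1 = i.castSucc
  · have h2 : (i : ℕ) < β.1.2 := by rw [h] at this; exact this
    simp only [h, true_and, if_true, Finsupp.single_apply]
    exact if_congr (by omega) rfl rfl
  · simp [h]

theorem sum_throws {r : ℕ} (f : PosRoot r → ℝ) (i : Fin r) :
    ((throws f i).sum fun _ x => x) = outflow f i.castSucc := by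
  have : ((throws f i).sum fun _ x => x) = Finsupp.liftAddHom (fun _ => AddMonoidHom.id ℝ) (throws f i) := by
    rw [Finsupp.liftAddHom_apply]
    rfl
  rw [this, throws, map_sum, outflow]
  refine Finset.sum_congr rfl fun β _ => ?_
  split_ifs <;> simp

theorem throws_apply_of_root {r : ℕ} (f : PosRoot r → ℝ) (β : PosRoot r) (i : Fin r)
    (hi : β.1.1 = i.castSucc) : throws f i ((β.1.2 : ℕ) - i - 1) = f β := by
  have hlt : (i : ℕ) < β.1.2 := by have := β.2; rw [hi] at this; exact this
  rw [throws_apply, Finset.sum_eq_single β]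
  · rw [if_pos ⟨hi, by omega⟩]
  · intro γ _ hne
    refine if_neg fun h => hne (Subtype.ext (Prod.ext (h.1.trans hi.symm) (Fin.ext ?_)))
    omega
  · simp

/-- Both sides collect the mass due at absolute time `i + 1 + j`; advancing the clock only adds the
throws made at time `i`. -/
theorem flowToSequence_succ {r : ℕ} (μ : Fin r → ℝ) (f : PosRoot r → ℝ) (i : Fin r) (j : ℕ) :
    flowToSequence μ f i.succ j = flowToSequence μ f i.castSucc (j + 1) + throws f i j := by
  rw [flowToSequence_apply, flowToSequence_apply, throws_apply, add_right_comm,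
    ← Finset.sum_add_distrib]
  congr 1
  · refine Finset.sum_congr rfl fun β _ => ?_
    simp only [Fin.lt_def, Fin.ext_iff, Fin.val_succ, Fin.val_castSucc]
    split_ifs <;> first | omega | simp
  · refine Finset.sum_congr rfl fun m _ => ?_
    simp only [Fin.val_succ, Fin.val_castSucc]
    exact if_congr (by omega) rfl rfl

/-- The flow of a juggling sequence: what is thrown at time `i` to land at time `j`. -/
def sequenceToFlow {r : ℕ} (S : Fin (r + 1) → ℕ →₀ ℝ) (β : PosRoot r) : ℝ :=
  S ⟨β.1.1 + 1, by have := β.2; omega⟩ ((β.1.2 : ℕ) - β.1.1 - 1) - S β.1.1 ((β.1.2 : ℕ) - β.1.1)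

theorem sequenceToFlow_eq {r : ℕ} (S : Fin (r + 1) → ℕ →₀ ℝ) (β : PosRoot r) (i : Fin r)
    (hi : β.1.1 = i.castSucc) : sequenceToFlow S β =
      S i.succ ((β.1.2 : ℕ) - i - 1) - S i.castSucc ((β.1.2 : ℕ) - i - 1 + 1) := by
  have hlt : (i : ℕ) < β.1.2 := by have := β.2; rw [hi] at this; exact this
  have h1 : (⟨β.1.1 + 1, by have := β.2; omega⟩ : Fin (r + 1)) = i.succ := by
    ext; simp [hi]
  rw [sequenceToFlow, h1, hi]
  simp only [Fin.val_castSucc]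
  congr 2
  omega

theorem PosRoot.exists_castSucc {r : ℕ} (β : PosRoot r) : ∃ i : Fin r, β.1.1 = i.castSucc :=
  ⟨⟨β.1.1, by have := β.2; omega⟩, rfl⟩

theorem sequenceToFlow_flowToSequence {r : ℕ} (μ : Fin r → ℝ) (f : PosRoot r → ℝ) :
    sequenceToFlow (flowToSequence μ f) = f := by
  funext β
  obtain ⟨i, hi⟩ := β.exists_castSucc
  rw [sequenceToFlow_eq _ β i hi, flowToSequence_succ, throws_apply_of_root f β i hi]
  ring

theorem flowToSequence_injective {r : ℕ} (μ : Fin r → ℝ) :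
    Function.Injective (flowToSequence μ) :=
  Function.LeftInverse.injective (sequenceToFlow_flowToSequence μ)

theorem flowToSequence_zero {r : ℕ} (μ : Fin r → ℝ) (f : PosRoot r → ℝ) :
    flowToSequence μ f 0 = state μ := by
  ext j
  simp [flowToSequence_apply]

theorem flowToSequence_last {r : ℕ} (μ : Fin r → ℝ) (f : PosRoot r → ℝ) :
    flowToSequence μ f (Fin.last r) = Finsupp.single 0 (inflow f (Fin.last r)) := by
  ext j
  rw [flowToSequence_apply, Finsupp.single_apply]
  have h2 : (∑ m : Fin r, if (m : ℕ) = (Fin.last r : ℕ) + j then μ m else 0) = 0 :=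
    Finset.sum_eq_zero fun m _ => if_neg (by simp only [Fin.val_last]; omega)
  rw [h2, add_zero]
  split_ifs with h
  · subst h
    refine Finset.sum_congr rfl fun β _ => if_congr ⟨fun h => Fin.ext h.2, fun h => ⟨?_, by simp [h]⟩⟩
      rfl rfl
    exact h ▸ β.2
  · exact Finset.sum_eq_zero fun β _ => if_neg (by simp only [Fin.val_last]; omega)

/-- This turns the juggling rule at time `i` into the netflow equation at the vertex `i`. -/
theorem flowToSequence_castSucc_zero {r : ℕ} (μ : Fin r → ℝ) (f : PosRoot r → ℝ) (i : Fin r) :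
    flowToSequence μ f i.castSucc 0 = inflow f i.castSucc + μ i := by
  rw [flowToSequence_apply, inflow]
  congr 1
  · refine Finset.sum_congr rfl fun β _ => if_congr ⟨fun h => Fin.ext (by simpa using h.2), fun h => ⟨?_, by simp [h]⟩⟩
      rfl rfl
    exact h ▸ β.2
  · simp [← Fin.ext_iff]

theorem state_singleton (x : ℝ) : state ![x] = Finsupp.single 0 x := by
  simp [state]

theorem flowToSequence_mem {r : ℕ} {μ : Fin r → ℝ} (hμ : ∀ i, 0 ≤ μ i) {f : PosRoot r → ℝ}
    (hf : f ∈ flowPolytope r (weight μ)) : flowToSequence μ f ∈ jugglingPolytope μ := by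
  rw [mem_flowPolytope_iff] at hf
  refine ⟨fun i j => ?_, flowToSequence_zero μ f, ?_, fun i => ⟨throws f i, fun j => ?_, ?_, ?_⟩⟩
  · rw [flowToSequence_apply]
    refine add_nonneg (Finset.sum_nonneg fun β _ => ?_) (Finset.sum_nonneg fun m _ => ?_)
    · split_ifs
      exacts [hf.1 β, le_rfl]
    · split_ifs
      exacts [hμ m, le_rfl]
  · have := hf.2 (Fin.last r)
    rw [outflow_last, weight_last] at this
    rw [flowToSequence_last, state_singleton]
    congr 1
    linarith
  · rw [throws_apply]
    refine Finset.sum_nonneg fun β _ => ?_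
    split_ifs
    exacts [hf.1 β, le_rfl]
  · have := hf.2 i.castSucc
    rw [weight_castSucc] at this
    rw [sum_throws, flowToSequence_castSucc_zero]
    linarith
  · exact flowToSequence_succ μ f i

/-- In a juggling sequence that ends in a state of height 1, the heights are bounded by the
remaining time. -/
theorem sequence_apply_eq_zero {r : ℕ} {a : ℕ →₀ ℝ} {x : ℝ} {S : Fin (r + 1) → ℕ →₀ ℝ}
    (hS : S ∈ RJS a (state ![x]) r) (i : Fin (r + 1)) :
    ∀ j : ℕ, r < i + j → S i j = 0 := by
  obtain ⟨hpos, -, hlast, hsucc⟩ := hS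
  induction i using Fin.reverseInduction with
  | last =>
    intro j hj
    rw [hlast, state_singleton, Finsupp.single_apply, if_neg]
    simp only [Fin.val_last] at hj
    omega
  | cast i ih =>
    intro j hj
    obtain ⟨b, hb, -, h⟩ := hsucc i
    obtain ⟨j, rfl⟩ : ∃ k, j = k + 1 := ⟨j - 1, by simp at hj; omega⟩
    have h1 := h j
    rw [ih j (by simp at hj ⊢; omega)] at h1
    have := hpos i.castSucc (j + 1)
    have := hb j
    linarith

theorem flowToSequence_sequenceToFlow {r : ℕ} {μ : Fin r → ℝ} {x : ℝ}
    {S : Fin (r + 1) → ℕ →₀ ℝ} (hS : S ∈ RJS (state μ) (state ![x]) r) :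
    flowToSequence μ (sequenceToFlow S) = S := by
  have hz := sequence_apply_eq_zero hS
  funext i
  induction i using Fin.induction with
  | zero => rw [flowToSequence_zero, hS.2.1]
  | succ i ih =>
    ext j
    rw [flowToSequence_succ, ih]
    by_cases hj : (i : ℕ) + 1 + j ≤ r
    · let β : PosRoot r := ⟨(i.castSucc, ⟨i + 1 + j, by omega⟩), by simp [Fin.lt_def]; omega⟩
      have h0 : (β.1.2 : ℕ) - i - 1 = j := by simp [β]; omega
      have h1 := throws_apply_of_root (sequenceToFlow S) β i rfl
      rw [sequenceToFlow_eq S β i rfl, h0] at h1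
      rw [h1]
      ring
    -- Landing times after `r` correspond to no edge; there the height bound makes both states
    -- vanish.
    · rw [hz i.succ j (by simp; omega), hz i.castSucc (j + 1) (by simp; omega), throws_apply,
        zero_add]
      exact Finset.sum_eq_zero fun β _ => if_neg (by omega)

theorem sequenceToFlow_mem {r : ℕ} {μ : Fin r → ℝ} {S : Fin (r + 1) → ℕ →₀ ℝ}
    (hS : S ∈ jugglingPolytope μ) : sequenceToFlow S ∈ flowPolytope r (weight μ) := by
  have hφ := flowToSequence_sequenceToFlow hS
  -- Two consecutive states determine the throws between them, so the witness in `Succeeds` is the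
  -- one coming from the flow.
  have hthrow : ∀ (i : Fin r) (b : ℕ →₀ ℝ), (∀ j, S i.succ j = S i.castSucc (j + 1) + b j) →
      b = throws (sequenceToFlow S) i := by
    intro i b hb
    ext j
    have := flowToSequence_succ μ (sequenceToFlow S) i j
    rw [hφ, hb] at this
    linarith
  rw [mem_flowPolytope_iff]
  refine ⟨fun β => ?_, fun i => ?_⟩
  · obtain ⟨i, hi⟩ := β.exists_castSucc
    obtain ⟨b, hb, -, h⟩ := hS.2.2.2 i
    rw [← throws_apply_of_root (sequenceToFlow S) β i hi, ← hthrow i b h]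
    exact hb _
  · induction i using Fin.lastCases with
    | last =>
      have h1 := flowToSequence_last μ (sequenceToFlow S)
      rw [hφ, hS.2.2.1, state_singleton] at h1
      have h2 := DFunLike.congr_fun h1 0
      simp only [Finsupp.single_eq_same] at h2
      rw [outflow_last, weight_last, ← h2, zero_sub]
    | cast i =>
      obtain ⟨b, -, hb, h⟩ := hS.2.2.2 i
      rw [hthrow i b h, sum_throws, ← hφ, flowToSequence_castSucc_zero, hφ] at hb
      rw [weight_castSucc, hb]
      ring

theorem image_flowToSequence {r : ℕ} {μ : Fin r → ℝ} (hμ : ∀ i, 0 ≤ μ i) :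
    flowToSequence μ '' flowPolytope r (weight μ) = jugglingPolytope μ := by
  refine Set.Subset.antisymm ?_ fun S hS => ?_
  · rintro _ ⟨f, hf, rfl⟩
    exact flowToSequence_mem hμ hf
  · exact ⟨_, sequenceToFlow_mem hS, flowToSequence_sequenceToFlow hS⟩

/-! ### Integrality -/

theorem exists_int_sum {ι : Type*} (s : Finset ι) {f : ι → ℝ} (hf : ∀ i ∈ s, ∃ z : ℤ, f i = z) :
    ∃ z : ℤ, ∑ i ∈ s, f i = z := by
  choose! z hz using hf
  exact ⟨∑ i ∈ s, z i, by rw [Finset.sum_congr rfl hz]; push_cast; rfl⟩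

theorem exists_int_ite {x : ℝ} (p : Prop) [Decidable p] (h : p → ∃ z : ℤ, x = z) :
    ∃ z : ℤ, (if p then x else 0) = z := by
  split_ifs with hp
  exacts [h hp, ⟨0, by simp⟩]

theorem exists_int_add {x y : ℝ} (hx : ∃ z : ℤ, x = z) (hy : ∃ z : ℤ, y = z) :
    ∃ z : ℤ, x + y = z := by
  obtain ⟨a, rfl⟩ := hx
  obtain ⟨b, rfl⟩ := hy
  exact ⟨a + b, by push_cast; rfl⟩

theorem exists_int_sub {x y : ℝ} (hx : ∃ z : ℤ, x = z) (hy : ∃ z : ℤ, y = z) :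
    ∃ z : ℤ, x - y = z := by
  obtain ⟨a, rfl⟩ := hx
  obtain ⟨b, rfl⟩ := hy
  exact ⟨a - b, by push_cast; rfl⟩

theorem sequenceToFlow_integral {r : ℕ} {S : Fin (r + 1) → ℕ →₀ ℝ}
    (hS : S ∈ integralSequences r) : sequenceToFlow S ∈ integralPoints (PosRoot r) :=
  fun _ => exists_int_sub (hS _ _) (hS _ _)

theorem flowToSequence_integral {r : ℕ} {μ : Fin r → ℝ} (hμ : μ ∈ integralPoints (Fin r))
    {f : PosRoot r → ℝ} (hf : f ∈ integralPoints (PosRoot r)) :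
    flowToSequence μ f ∈ integralSequences r := by
  intro i j
  rw [flowToSequence_apply]
  exact exists_int_add (exists_int_sum _ fun β _ => exists_int_ite _ fun _ => hf β)
    (exists_int_sum _ fun m _ => exists_int_ite _ fun _ => hμ m)

/-- The set `A` is arbitrary so that this serves both for the polytope (counting) and for its affine
span (lattice charts and integral equivalence). -/
theorem image_flowToSequence_integral_inter {r : ℕ} {μ : Fin r → ℝ}
    (hμ : μ ∈ integralPoints (Fin r)) (A : Set (PosRoot r → ℝ)) :
    flowToSequence μ '' (integralPoints (PosRoot r) ∩ A) =
      integralSequences r ∩ flowToSequence μ '' A := by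
  ext S
  constructor
  · rintro ⟨f, ⟨hf, hA⟩, rfl⟩
    exact ⟨flowToSequence_integral hμ hf, f, hA, rfl⟩
  · rintro ⟨hS, f, hA, rfl⟩
    refine ⟨f, ⟨?_, hA⟩, rfl⟩
    have := sequenceToFlow_integral hS
    rwa [sequenceToFlow_flowToSequence] at this

/-! ### Sequences of natural numbers -/

/-- A sequence of natural states as a sequence of real states. -/
def castSequence {n : ℕ} (S : Fin (n + 1) → ℕ →₀ ℕ) : Fin (n + 1) → ℕ →₀ ℝ :=
  fun i => (S i).mapRange (fun x : ℕ => (x : ℝ)) Nat.cast_zero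

theorem castSequence_injective {n : ℕ} : Function.Injective (castSequence (n := n)) := by
  intro S T h
  funext i
  exact Finsupp.mapRange_injective _ Nat.cast_zero Nat.cast_injective (congrFun h i)

theorem mapRange_cast_state {r : ℕ} (μ : Fin r → ℕ) :
    (state μ).mapRange (fun x : ℕ => (x : ℝ)) Nat.cast_zero = state fun i => (μ i : ℝ) := by
  ext j
  simp

/-- Real throws between natural states are the differences `t j - s (j + 1)`, hence natural numbers;
the floor in the proof merely names them. -/
theorem succeeds_cast_iff {s t : ℕ →₀ ℕ} :
    Succeeds (s.mapRange (fun x : ℕ => (x : ℝ)) Nat.cast_zero)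
      (t.mapRange (fun x : ℕ => (x : ℝ)) Nat.cast_zero) ↔ Succeeds s t := by
  have hsum : ∀ b : ℕ →₀ ℕ, ((b.mapRange (fun x : ℕ => (x : ℝ)) Nat.cast_zero).sum fun _ x => x) =
      ((b.sum fun _ x => x : ℕ) : ℝ) := by
    intro b
    rw [Finsupp.sum_mapRange_index (fun _ => rfl), Finsupp.sum, Finsupp.sum]
    push_cast
    rfl
  constructor
  · rintro ⟨b, hb, hs, h⟩
    simp only [Finsupp.mapRange_apply] at h hs
    have hle : ∀ j, s (j + 1) ≤ t j := fun j => by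
      have := hb j
      have := h j
      exact_mod_cast (by linarith : (s (j + 1) : ℝ) ≤ t j)
    have hbe : b = (b.mapRange (fun x : ℝ => ⌊x⌋₊) (by simp)).mapRange
        (fun x : ℕ => (x : ℝ)) Nat.cast_zero := by
      ext j
      have : b j = ((t j - s (j + 1) : ℕ) : ℝ) := by
        rw [Nat.cast_sub (hle j)]
        linarith [h j]
      simp [this]
    set c := b.mapRange (fun x : ℝ => ⌊x⌋₊) (by simp)
    refine ⟨c, fun _ => zero_le, ?_, fun j => ?_⟩
    · rw [hbe, hsum] at hs
      exact_mod_cast hs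
    · have := h j
      rw [hbe] at this
      simp only [Finsupp.mapRange_apply] at this
      exact_mod_cast this
  · rintro ⟨b, -, hs, h⟩
    refine ⟨b.mapRange (fun x : ℕ => (x : ℝ)) Nat.cast_zero, fun j => by simp, ?_, fun j => ?_⟩
    · rw [hsum, hs]
      simp
    · simp [h j]

theorem image_castSequence {n : ℕ} (a b : ℕ →₀ ℕ) :
    castSequence '' JS a b n = integralSequences n ∩
      RJS (a.mapRange (fun x : ℕ => (x : ℝ)) Nat.cast_zero)
        (b.mapRange (fun x : ℕ => (x : ℝ)) Nat.cast_zero) n := by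
  have hinj : Function.Injective fun s : ℕ →₀ ℕ => s.mapRange (fun x : ℕ => (x : ℝ)) Nat.cast_zero :=
    Finsupp.mapRange_injective _ Nat.cast_zero Nat.cast_injective
  ext S
  constructor
  · rintro ⟨T, ⟨-, ha, hb, hs⟩, rfl⟩
    refine ⟨fun i j => ⟨T i j, by simp [castSequence]⟩, fun i j => by simp [castSequence],
      congrArg (fun s : ℕ →₀ ℕ => s.mapRange (fun x : ℕ => (x : ℝ)) Nat.cast_zero) ha,
      congrArg (fun s : ℕ →₀ ℕ => s.mapRange (fun x : ℕ => (x : ℝ)) Nat.cast_zero) hb,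
      fun i => succeeds_cast_iff.2 (hs i)⟩
  · rintro ⟨hint, hpos, ha, hb, hs⟩
    have hST : S = castSequence fun i => (S i).mapRange (fun x : ℝ => ⌊x⌋₊) (by simp) := by
      funext i
      ext j
      obtain ⟨z, hz⟩ := hint i j
      have h0 := hpos i j
      rw [hz] at h0
      lift z to ℕ using by exact_mod_cast h0
      simp [castSequence, hz]
    set T : Fin (n + 1) → ℕ →₀ ℕ := fun i => (S i).mapRange (fun x : ℝ => ⌊x⌋₊) (by simp)
    rw [hST] at ha hb hs
    exact ⟨T, ⟨fun _ _ => zero_le, hinj ha, hinj hb, fun i => succeeds_cast_iff.1 (hs i)⟩,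
      hST.symm⟩

theorem image_castSequence_JS {r : ℕ} (μ : Fin r → ℕ) (x : ℕ) (hx : x = ∑ i, μ i) :
    castSequence '' JS (state μ) (state ![x]) r =
      integralSequences r ∩ jugglingPolytope fun i => (μ i : ℝ) := by
  rw [image_castSequence, mapRange_cast_state, mapRange_cast_state, jugglingPolytope]
  congr 4
  funext i
  fin_cases i
  simp [hx]

/-! ### Vertices of flow polytopes -/

theorem outflow_add {r : ℕ} (f g : PosRoot r → ℝ) (i : Fin (r + 1)) :
    outflow (f + g) i = outflow f i + outflow g i := by
  simp only [outflow, ← Finset.sum_add_distrib]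
  exact Finset.sum_congr rfl fun β _ => by split_ifs <;> simp

theorem inflow_add {r : ℕ} (f g : PosRoot r → ℝ) (i : Fin (r + 1)) :
    inflow (f + g) i = inflow f i + inflow g i := by
  simp only [inflow, ← Finset.sum_add_distrib]
  exact Finset.sum_congr rfl fun β _ => by split_ifs <;> simp

theorem outflow_smul {r : ℕ} (c : ℝ) (f : PosRoot r → ℝ) (i : Fin (r + 1)) :
    outflow (c • f) i = c * outflow f i := by
  simp [outflow, Finset.mul_sum]

theorem inflow_smul {r : ℕ} (c : ℝ) (f : PosRoot r → ℝ) (i : Fin (r + 1)) :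
    inflow (c • f) i = c * inflow f i := by
  simp [inflow, Finset.mul_sum]

theorem outflow_single {r : ℕ} (γ : PosRoot r) (i : Fin (r + 1)) :
    outflow (Pi.single γ 1) i = if γ.1.1 = i then 1 else 0 := by
  rw [outflow, Finset.sum_eq_single γ] <;> simp +contextual

theorem inflow_single {r : ℕ} (γ : PosRoot r) (i : Fin (r + 1)) :
    inflow (Pi.single γ 1) i = if γ.1.2 = i then 1 else 0 := by
  rw [inflow, Finset.sum_eq_single γ] <;> simp +contextual

theorem inflow_pos {r : ℕ} {f : PosRoot r → ℝ} (hf : ∀ β, 0 ≤ f β) {γ : PosRoot r}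
    (hγ : 0 < f γ) : 0 < inflow f γ.1.2 := by
  refine Finset.sum_pos' (fun β _ => ?_) ⟨γ, Finset.mem_univ _, by simpa using hγ⟩
  split_ifs
  exacts [hf β, le_rfl]

/-- From a vertex that a flow enters, a path in the support of the flow leads to the sink. -/
theorem exists_unit_flow {r : ℕ} {μ : Fin r → ℝ} (hμ : ∀ i, 0 ≤ μ i) {f : PosRoot r → ℝ}
    (hf : f ∈ flowPolytope r (weight μ)) (j : Fin (r + 1)) :
    (j = Fin.last r ∨ 0 < inflow f j) → ∃ u : PosRoot r → ℝ,
      (∀ i, outflow u i - inflow u i =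
        (if j = i then 1 else 0) - (if Fin.last r = i then 1 else 0)) ∧
      ∀ β, u β ≠ 0 → 0 < f β ∧ j ≤ β.1.1 := by
  rw [mem_flowPolytope_iff] at hf
  induction j using WellFoundedGT.induction with
  | _ j ih =>
    intro hj
    by_cases hl : j = Fin.last r
    · exact ⟨0, fun i => by simp [hl, outflow, inflow], fun β h => absurd rfl h⟩
    have hin := hj.resolve_left hl
    obtain ⟨i, rfl⟩ := Fin.exists_castSucc_eq.2 hl
    -- The outflow is `μ i` plus a positive inflow, so some edge of positive flow continues the
    -- path.
    have hout : 0 < outflow f i.castSucc := by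
      have := hf.2 i.castSucc
      rw [weight_castSucc] at this
      linarith [hμ i]
    obtain ⟨γ, -, hγ⟩ := Finset.exists_lt_of_sum_lt (f := fun _ => (0 : ℝ))
      (by rwa [Finset.sum_const_zero] : _ < outflow f i.castSucc)
    by_cases hγi : γ.1.1 = i.castSucc
    · rw [if_pos hγi] at hγ
      have hlt : i.castSucc < γ.1.2 := hγi ▸ γ.2
      obtain ⟨u, hu1, hu2⟩ := ih γ.1.2 hlt (Or.inr (inflow_pos hf.1 hγ))
      refine ⟨Pi.single γ 1 + u, fun k => ?_, fun β hβ => ?_⟩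
      · rw [outflow_add, inflow_add, outflow_single, inflow_single, hγi]
        linarith [hu1 k]
      · by_cases h : β = γ
        · subst h
          exact ⟨hγ, hγi.ge⟩
        · have : u β ≠ 0 := by simpa [Pi.single_apply, h] using hβ
          exact ⟨(hu2 β this).1, hlt.le.trans (hu2 β this).2⟩
    · rw [if_neg hγi] at hγ
      exact absurd hγ (lt_irrefl _)

/-- A vertex of a flow polytope does not admit a circulation in its support. -/
theorem eq_zero_of_mem_extremePoints {r : ℕ} {w : Fin (r + 1) → ℝ} {f h : PosRoot r → ℝ}
    (hf : f ∈ (flowPolytope r w).extremePoints ℝ) (hh : ∀ i, outflow h i - inflow h i = 0)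
    (hsupp : ∀ β, h β ≠ 0 → 0 < f β) : h = 0 := by
  obtain ⟨hmem, hext⟩ := hf
  rw [mem_flowPolytope_iff] at hmem
  -- As `h` lives where `f` is positive, a small multiple of `h` may be added or subtracted without
  -- losing nonnegativity; `f` is the midpoint of the two results.
  obtain ⟨ε, hε, hεle⟩ : ∃ ε : ℝ, 0 < ε ∧ ∀ β, ε * |h β| ≤ f β := by
    have : ∀ᶠ ε : ℝ in nhdsWithin 0 (Set.Ioi 0), ∀ β, ε * |h β| ≤ f β := by
      rw [Filter.eventually_all]
      intro β
      by_cases hβ : h β = 0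
      · simp [hβ, hmem.1 β]
      · have : Filter.Tendsto (fun ε : ℝ => ε * |h β|) (nhds 0) (nhds (0 * |h β|)) :=
          (continuous_id.mul continuous_const).tendsto 0
        rw [zero_mul] at this
        exact ((this.eventually_lt_const (hsupp β hβ)).filter_mono nhdsWithin_le_nhds).mono
          fun _ h => h.le
    obtain ⟨ε, h1, h2⟩ := (this.and self_mem_nhdsWithin).exists
    exact ⟨ε, h2, h1⟩
  have key : ∀ c : ℝ, |c| = ε → f + c • h ∈ flowPolytope r w := by
    intro c hc
    rw [mem_flowPolytope_iff]
    refine ⟨fun β => ?_, fun i => ?_⟩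
    · have h1 := hεle β
      rw [← hc, ← abs_mul] at h1
      have h2 := neg_abs_le (c * h β)
      simp only [Pi.add_apply, Pi.smul_apply, smul_eq_mul]
      linarith
    · rw [outflow_add, inflow_add, outflow_smul, inflow_smul]
      linear_combination hmem.2 i + c * hh i
  have hseg : f ∈ openSegment ℝ (f + ε • h) (f + (-ε) • h) :=
    ⟨1 / 2, 1 / 2, by norm_num, by norm_num, by norm_num, by
      ext β; simp only [Pi.add_apply, Pi.smul_apply, smul_eq_mul]; ring⟩
  have := hext (key ε (abs_of_pos hε)) (key (-ε) (by rw [abs_neg, abs_of_pos hε])) hseg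
  funext β
  have h3 := congrFun this β
  simp only [Pi.add_apply, Pi.smul_apply, smul_eq_mul, add_eq_left, mul_eq_zero] at h3
  exact h3.resolve_left hε.ne'

/-- At a vertex of a flow polytope, all that leaves a vertex of the graph takes the same edge. -/
theorem eq_of_mem_extremePoints {r : ℕ} {μ : Fin r → ℝ} (hμ : ∀ i, 0 ≤ μ i) {f : PosRoot r → ℝ}
    (hf : f ∈ (flowPolytope r (weight μ)).extremePoints ℝ) {β γ : PosRoot r} (hβ : 0 < f β)
    (hγ : 0 < f γ) (h : β.1.1 = γ.1.1) : β = γ := by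
  by_contra hne
  have hpos := (mem_flowPolytope_iff.1 hf.1).1
  obtain ⟨u, hu1, hu2⟩ := exists_unit_flow hμ hf.1 β.1.2 (Or.inr (inflow_pos hpos hβ))
  obtain ⟨v, hv1, hv2⟩ := exists_unit_flow hμ hf.1 γ.1.2 (Or.inr (inflow_pos hpos hγ))
  have huβ : u β = 0 := by
    by_contra h0
    exact ((hu2 β h0).2.trans_lt β.2).ne rfl
  have hvβ : v β = 0 := by
    by_contra h0
    exact ((hv2 β h0).2.trans_lt (h ▸ γ.2)).ne rfl
  -- Follow `β` and then `u` to the sink, and return along `v` and `γ` reversed. The coefficient at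
  -- `β` is 1, since `u` and `v` use only edges with later tails.
  have key := eq_zero_of_mem_extremePoints (h := Pi.single β 1 + u + (-1 : ℝ) • (Pi.single γ 1 + v))
    hf (fun i => ?_) fun δ hδ => ?_
  · have := congrFun key β
    simp [hne, huβ, hvβ] at this
  · simp only [outflow_add, inflow_add, outflow_smul, inflow_smul, outflow_single, inflow_single, h]
    linear_combination hu1 i - hv1 i
  · by_cases h1 : δ = β
    · exact h1 ▸ hβ
    by_cases h2 : δ = γ
    · exact h2 ▸ hγ
    by_cases h3 : u δ = 0
    · refine (hv2 δ fun h4 => hδ ?_).1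
      simp [h1, h2, h3, h4]
    · exact (hu2 δ h3).1

/-- Induction on the tail: the only edge carrying flow out of a vertex carries its supply plus its
inflow, and the inflow comes from earlier tails. -/
theorem integral_of_mem_extremePoints {r : ℕ} {μ : Fin r → ℝ} (hμ : ∀ i, 0 ≤ μ i)
    (hint : μ ∈ integralPoints (Fin r)) {f : PosRoot r → ℝ}
    (hf : f ∈ (flowPolytope r (weight μ)).extremePoints ℝ) : f ∈ integralPoints (PosRoot r) := by
  have hmem := mem_flowPolytope_iff.1 hf.1
  suffices ∀ (i : Fin (r + 1)) (β : PosRoot r), β.1.1 = i → ∃ z : ℤ, f β = z from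
    fun β => this _ β rfl
  intro i
  induction i using WellFoundedLT.induction with
  | _ i ih =>
    intro β hβ
    rcases (hmem.1 β).eq_or_lt with h0 | hpos
    · exact ⟨0, by simp [← h0]⟩
    obtain ⟨k, rfl⟩ : ∃ k : Fin r, i = k.castSucc := hβ ▸ β.exists_castSucc
    have hout : outflow f k.castSucc = f β := by
      rw [outflow, Finset.sum_eq_single β, if_pos hβ]
      · intro γ _ hne
        split_ifs with hγ
        · by_contra h
          exact hne (eq_of_mem_extremePoints hμ hf ((hmem.1 γ).lt_of_ne' h) hpos
            (hγ.trans hβ.symm))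
        · rfl
      · simp
    have heq : f β = μ k + inflow f k.castSucc := by
      have := hmem.2 k.castSucc
      rw [weight_castSucc, hout] at this
      linarith
    rw [heq]
    exact exists_int_add (hint k) (exists_int_sum _ fun γ _ => exists_int_ite _ fun h =>
      ih _ (h ▸ γ.2) γ rfl)

/-! ### Flow polytopes are polytopes -/

theorem continuous_outflow {r : ℕ} (i : Fin (r + 1)) :
    Continuous fun f : PosRoot r → ℝ => outflow f i :=
  continuous_finsetSum _ fun β _ => by split_ifs <;> fun_prop

theorem continuous_inflow {r : ℕ} (i : Fin (r + 1)) :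
    Continuous fun f : PosRoot r → ℝ => inflow f i :=
  continuous_finsetSum _ fun β _ => by split_ifs <;> fun_prop

theorem isClosed_flowPolytope {r : ℕ} (w : Fin (r + 1) → ℝ) : IsClosed (flowPolytope r w) := by
  have : flowPolytope r w = (⋂ β, {f | 0 ≤ f β}) ∩ ⋂ i, {f | outflow f i - inflow f i = w i} := by
    ext f
    simp [mem_flowPolytope_iff]
  rw [this]
  exact (isClosed_iInter fun β => isClosed_le continuous_const (continuous_apply β)).inter
    (isClosed_iInter fun i => isClosed_eq ((continuous_outflow i).sub (continuous_inflow i))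
      continuous_const)

theorem convex_flowPolytope {r : ℕ} (w : Fin (r + 1) → ℝ) : Convex ℝ (flowPolytope r w) := by
  intro f hf g hg a b ha hb hab
  rw [mem_flowPolytope_iff] at hf hg ⊢
  refine ⟨fun β => ?_, fun i => ?_⟩
  · exact add_nonneg (mul_nonneg ha (hf.1 β)) (mul_nonneg hb (hg.1 β))
  · simp only [outflow_add, inflow_add, outflow_smul, inflow_smul]
    linear_combination a * hf.2 i + b * hg.2 i + w i * hab

/-- Pairing the netflow equation with the potential `i` at vertex `i` gives a sum of `f γ` weighted
by the length of `γ`, and every length is at least 1. -/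
theorem apply_le_of_mem_flowPolytope {r : ℕ} {w : Fin (r + 1) → ℝ} {f : PosRoot r → ℝ}
    (hf : f ∈ flowPolytope r w) (β : PosRoot r) : f β ≤ -∑ i : Fin (r + 1), (i : ℝ) * w i := by
  have hsum : ∑ γ : PosRoot r, f γ * (((γ.1.2 : ℕ) : ℝ) - ((γ.1.1 : ℕ) : ℝ)) =
      -∑ i : Fin (r + 1), (i : ℝ) * w i := by
    rw [← hf.2]
    simp only [Finset.sum_apply, Finset.mul_sum]
    rw [Finset.sum_comm, ← Finset.sum_neg_distrib]
    refine Finset.sum_congr rfl fun γ _ => ?_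
    simp only [PosRoot.vec, Pi.smul_apply, Pi.sub_apply, Pi.single_apply, smul_eq_mul, mul_sub,
      mul_ite, mul_one, mul_zero, Finset.sum_sub_distrib, Finset.sum_ite_eq', Finset.mem_univ,
      if_true]
    ring
  have hge : ∀ γ : PosRoot r, f γ ≤ f γ * (((γ.1.2 : ℕ) : ℝ) - ((γ.1.1 : ℕ) : ℝ)) := by
    intro γ
    have : ((γ.1.1 : ℕ) : ℝ) + 1 ≤ ((γ.1.2 : ℕ) : ℝ) := by exact_mod_cast γ.2
    nlinarith [hf.1 γ]
  rw [← hsum]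
  exact (hge β).trans (Finset.single_le_sum (f := fun γ : PosRoot r =>
    f γ * (((γ.1.2 : ℕ) : ℝ) - ((γ.1.1 : ℕ) : ℝ)))
    (fun γ _ => (hf.1 γ).trans (hge γ)) (Finset.mem_univ β))

theorem isCompact_flowPolytope {r : ℕ} (w : Fin (r + 1) → ℝ) : IsCompact (flowPolytope r w) :=
  (isCompact_univ_pi fun _ : PosRoot r => isCompact_Icc).of_isClosed_subset
    (isClosed_flowPolytope w) fun _ hf β _ => ⟨hf.1 β, apply_le_of_mem_flowPolytope hf β⟩

theorem finite_integralPoints_inter {r : ℕ} (w : Fin (r + 1) → ℝ) :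
    (integralPoints (PosRoot r) ∩ flowPolytope r w).Finite := by
  refine (Set.Finite.pi' fun _ : PosRoot r => (Set.finite_Icc 0
    ⌊-∑ i : Fin (r + 1), (i : ℝ) * w i⌋).image fun z : ℤ => (z : ℝ)).subset ?_
  rintro f ⟨hint, hf⟩ β
  obtain ⟨z, hz⟩ := hint β
  refine ⟨z, ⟨?_, ?_⟩, hz.symm⟩
  · have := hf.1 β
    rw [hz] at this
    exact_mod_cast this
  · rw [Int.le_floor, ← hz]
    exact apply_le_of_mem_flowPolytope hf β

theorem convexHull_extremePoints_flowPolytope {r : ℕ} {μ : Fin r → ℝ} (hμ : ∀ i, 0 ≤ μ i)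
    (hint : μ ∈ integralPoints (Fin r)) :
    ((flowPolytope r (weight μ)).extremePoints ℝ).Finite ∧
      convexHull ℝ ((flowPolytope r (weight μ)).extremePoints ℝ) = flowPolytope r (weight μ) := by
  have hfin : ((flowPolytope r (weight μ)).extremePoints ℝ).Finite :=
    (finite_integralPoints_inter (weight μ)).subset fun f hf =>
      ⟨integral_of_mem_extremePoints hμ hint hf, hf.1⟩
  refine ⟨hfin, ?_⟩
  have := closure_convexHull_extremePoints (isCompact_flowPolytope (weight μ))
    (convex_flowPolytope (weight μ))
  rwa [(hfin.isClosed_convexHull ℝ).closure_eq] at this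

/-! ### Sums of polynomials -/

theorem exists_polynomial_sum_pow (m : ℕ) :
    ∃ q : Polynomial ℚ, ∀ n : ℕ, q.eval (n : ℚ) = ∑ k ∈ Finset.range n, (k : ℚ) ^ m :=
  ⟨∑ i ∈ Finset.range (m + 1), Polynomial.C (bernoulli i * ((m + 1).choose i) / ((m : ℚ) + 1)) *
    Polynomial.X ^ (m + 1 - i), fun n => by
      rw [sum_range_pow, Polynomial.eval_finsetSum]
      refine Finset.sum_congr rfl fun i _ => ?_
      simp only [Polynomial.eval_mul, Polynomial.eval_C, Polynomial.eval_pow, Polynomial.eval_X]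
      ring⟩

/-- The ring is general because the coefficients will themselves be polynomials in the supply. -/
theorem exists_polynomial_sum_range {R : Type*} [CommRing R] [Algebra ℚ R] (Q : Polynomial R) :
    ∃ Q' : Polynomial R, ∀ n : ℕ, Q'.eval (n : R) = ∑ k ∈ Finset.range n, Q.eval (k : R) := by
  induction Q using Polynomial.induction_on' with
  | add p q hp hq =>
    obtain ⟨p', hp⟩ := hp
    obtain ⟨q', hq⟩ := hq
    exact ⟨p' + q', fun n => by simp [hp, hq, Finset.sum_add_distrib]⟩
  | monomial m c =>
    obtain ⟨q, hq⟩ := exists_polynomial_sum_pow m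
    refine ⟨Polynomial.C c * q.map (algebraMap ℚ R), fun n => ?_⟩
    have h := congrArg (algebraMap ℚ R) (hq n)
    rw [← Polynomial.eval_map_apply] at h
    simp only [map_natCast, map_sum, map_pow] at h
    simp [h, Finset.mul_sum]

/-- Move `x` units from `i` to `j`. -/
def shift {σ : Type*} [DecidableEq σ] (i j : σ) (x : ℕ) (a : σ → ℕ) : σ → ℕ :=
  fun s => a s - (if s = i then x else 0) + if s = j then x else 0

/-- Substituting the shifted supply makes `P` a polynomial `Q` in the amount moved, over
`MvPolynomial σ ℚ`; Faulhaber's formula sums it, and the upper limit is then specialised to `X i +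
1`. -/
theorem exists_mvPolynomial_sum_shift {σ : Type*} [DecidableEq σ] (i j : σ) (P : MvPolynomial σ ℚ) :
    ∃ P' : MvPolynomial σ ℚ, ∀ a : σ → ℕ, MvPolynomial.eval (fun s => (a s : ℚ)) P' =
      ∑ x ∈ Finset.range (a i + 1), MvPolynomial.eval (fun s => (shift i j x a s : ℚ)) P := by
  let Q : Polynomial (MvPolynomial σ ℚ) := MvPolynomial.aeval (fun s =>
    Polynomial.C (MvPolynomial.X s) - (if s = i then Polynomial.X else 0) +
      if s = j then Polynomial.X else 0) P
  obtain ⟨Q', hQ'⟩ := exists_polynomial_sum_range Q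
  refine ⟨Q'.eval (MvPolynomial.X i + 1), fun a => ?_⟩
  set e := MvPolynomial.eval (fun s => (a s : ℚ)) with he
  -- `hQ'` concerns natural arguments only. Under `e` the argument `X i + 1` becomes the number `a i
  -- + 1`, where it applies.
  have h1 : ∀ n : ℕ, e (Q'.eval (n : MvPolynomial σ ℚ)) = (Q'.map e).eval (n : ℚ) := fun n => by
    rw [← Polynomial.eval_map_apply, map_natCast]
  have h2 : e (Q'.eval (MvPolynomial.X i + 1)) = (Q'.map e).eval ((a i + 1 : ℕ) : ℚ) := by
    rw [← Polynomial.eval_map_apply]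
    simp [he]
  rw [h2, ← h1, hQ', map_sum]
  refine Finset.sum_congr rfl fun x hx => ?_
  -- This bound keeps the natural subtraction in `shift` from truncating.
  have hx' : x ≤ a i := Nat.lt_succ_iff.1 (Finset.mem_range.1 hx)
  have h3 : e (Q.eval (x : MvPolynomial σ ℚ)) =
      ((e.comp (Polynomial.evalRingHom (x : MvPolynomial σ ℚ))).comp
        (MvPolynomial.aeval (R := ℚ) (fun s =>
          Polynomial.C (MvPolynomial.X s) - (if s = i then Polynomial.X else 0) +
          if s = j then Polynomial.X else 0) : MvPolynomial σ ℚ →ₐ[ℚ] _).toRingHom) P := rfl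
  rw [h3]
  congr 1
  refine MvPolynomial.ringHom_ext (fun c => by simp [he]) fun s => ?_
  simp only [RingHom.comp_apply, AlgHom.toRingHom_eq_coe, RingHom.coe_coe, MvPolynomial.aeval_X,
    MvPolynomial.eval_X, shift, Polynomial.coe_evalRingHom, Polynomial.eval_C, map_add, map_sub]
  have h4 : (if s = i then x else 0) ≤ a s := by
    split_ifs with h
    · exact h ▸ hx'
    · exact Nat.zero_le _
  rw [Nat.cast_add, Nat.cast_sub h4]
  congr 1
  · congr 1
    · simp [he]
    · split_ifs <;> simp
  · split_ifs <;> simp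

/-! ### Counting flows on an acyclic graph -/

section Count

variable {σ E : Type*} [DecidableEq σ] (tail head : E → σ)

/-- The edges in the list are served one after the other, and none takes more than its tail then
holds. -/
def Admissible : List E → (σ → ℕ) → (E → ℕ) → Prop
  | [], _, _ => True
  | e :: L, a, g => g e ≤ a (tail e) ∧ Admissible L (shift (tail e) (head e) (g e) a) g

theorem admissible_congr {L : List E} {a : σ → ℕ} {g g' : E → ℕ} (h : ∀ e ∈ L, g e = g' e) :
    Admissible tail head L a g ↔ Admissible tail head L a g' := by
  induction L generalizing a with
  | nil => exact Iff.rfl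
  | cons e L ih =>
    simp only [Admissible, h e List.mem_cons_self]
    rw [ih fun e he => h e (List.mem_cons_of_mem _ he)]

/-- The admissible functions supported on the list. -/
def admissibleSet (L : List E) (a : σ → ℕ) : Set (E → ℕ) :=
  {g | (∀ e ∉ L, g e = 0) ∧ Admissible tail head L a g}

theorem admissibleSet_cons [DecidableEq E] {e : E} {L : List E} (he : e ∉ L) (a : σ → ℕ) :
    admissibleSet tail head (e :: L) a = ⋃ x ∈ Finset.range (a (tail e) + 1),
      (fun g => Function.update g e x) ''
        admissibleSet tail head L (shift (tail e) (head e) x a) := by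
  ext g
  simp only [Set.mem_iUnion, Finset.mem_range, Set.mem_image, exists_prop]
  constructor
  · rintro ⟨h0, hle, hadm⟩
    refine ⟨g e, Nat.lt_succ_of_le hle, Function.update g e 0, ⟨fun e' he' => ?_, ?_⟩, by simp⟩
    · by_cases h : e' = e
      · simp [h]
      · rw [Function.update_of_ne h]
        exact h0 e' (by simp [h, he'])
    · refine (admissible_congr tail head fun e' he' => ?_).1 hadm
      rw [Function.update_of_ne (by rintro rfl; exact he he')]
  · rintro ⟨x, hx, g, ⟨h0, hadm⟩, rfl⟩
    refine ⟨fun e' he' => ?_, ?_, ?_⟩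
    · rw [Function.update_of_ne (by rintro rfl; exact he' List.mem_cons_self)]
      exact h0 e' fun h => he' (List.mem_cons_of_mem _ h)
    · simpa using Nat.lt_succ_iff.1 hx
    · rw [Function.update_self]
      refine (admissible_congr tail head fun e' he' => ?_).1 hadm
      rw [Function.update_of_ne (by rintro rfl; exact he he')]

theorem admissibleSet_finite [DecidableEq E] {L : List E} (hL : L.Nodup) (a : σ → ℕ) :
    (admissibleSet tail head L a).Finite := by
  induction L generalizing a with
  | nil =>
    refine (Set.finite_singleton (0 : E → ℕ)).subset fun g hg => ?_
    exact funext fun e => hg.1 e (by simp)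
  | cons e L ih =>
    rw [List.nodup_cons] at hL
    rw [admissibleSet_cons tail head hL.1]
    exact (Finset.range _).finite_toSet.biUnion fun x _ => (ih hL.2 _).image _

theorem ncard_admissibleSet_cons [DecidableEq E] {e : E} {L : List E} (hL : (e :: L).Nodup) (a : σ → ℕ) :
    (admissibleSet tail head (e :: L) a).ncard = ∑ x ∈ Finset.range (a (tail e) + 1),
      (admissibleSet tail head L (shift (tail e) (head e) x a)).ncard := by
  rw [List.nodup_cons] at hL
  rw [admissibleSet_cons tail head hL.1]
  refine (Set.Finite.ncard_biUnion (Finset.range (a (tail e) + 1)).finite_toSet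
      (fun x _ => (admissibleSet_finite tail head hL.2 _).image _) ?_).trans ?_
  rotate_left
  · rw [finsum_mem_coe_finset]
    refine Finset.sum_congr rfl fun x _ => Set.InjOn.ncard_image ?_
    intro g hg g' hg' h
    funext e'
    by_cases h' : e' = e
    · rw [h', hg.1 e hL.1, hg'.1 e hL.1]
    · have := congrFun h e'
      simpa [Function.update_of_ne h'] using this
  · intro x _ y _ hxy
    refine Set.disjoint_left.2 ?_
    rintro _ ⟨g, -, rfl⟩ ⟨g', -, h⟩
    have := congrFun h e
    simp only [Function.update_self] at this
    exact hxy this.symm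

theorem exists_mvPolynomial_ncard_admissibleSet [DecidableEq E] {L : List E} (hL : L.Nodup) :
    ∃ P : MvPolynomial σ ℚ, ∀ a : σ → ℕ,
      ((admissibleSet tail head L a).ncard : ℚ) = MvPolynomial.eval (fun s => (a s : ℚ)) P := by
  induction L with
  | nil =>
    refine ⟨1, fun a => ?_⟩
    have : admissibleSet tail head [] a = {0} := by
      ext g
      simp [admissibleSet, Admissible, funext_iff]
    simp [this]
  | cons e L ih =>
    obtain ⟨P, hP⟩ := ih (List.nodup_cons.1 hL).2
    obtain ⟨P', hP'⟩ := exists_mvPolynomial_sum_shift (tail e) (head e) P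
    refine ⟨P', fun a => ?_⟩
    rw [ncard_admissibleSet_cons tail head hL, hP', Nat.cast_sum]
    exact Finset.sum_congr rfl fun x _ => hP _

/-- If no edge of the list enters the tail of an earlier one, the functions that are admissible for
the list are those whose outflow at each vertex is covered by the supply and the inflow. -/
theorem admissible_iff {L : List E} (hne : ∀ e ∈ L, head e ≠ tail e)
    (hL : L.Pairwise fun e e' => head e' ≠ tail e) (a : σ → ℕ) (g : E → ℕ) :
    Admissible tail head L a g ↔ ∀ s, (L.map fun e => if tail e = s then g e else 0).sum ≤
      a s + (L.map fun e => if head e = s then g e else 0).sum := by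
  induction L generalizing a with
  | nil => simp [Admissible]
  | cons e L ih =>
    rw [List.pairwise_cons] at hL
    -- No later edge refills `tail e`, so the total condition there already bounds `g e` by the
    -- present supply.
    have hin : (L.map fun e' => if head e' = tail e then g e' else 0).sum = 0 := by
      refine List.sum_eq_zero fun x hx => ?_
      obtain ⟨e', he', rfl⟩ := List.mem_map.1 hx
      exact if_neg (hL.1 e' he')
    have hhe := hne e List.mem_cons_self
    rw [Admissible, ih (fun e he => hne e (List.mem_cons_of_mem _ he)) hL.2]
    simp only [List.map_cons, List.sum_cons, shift]
    constructor
    · rintro ⟨h1, h2⟩ s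
      have := h2 s
      by_cases hs : s = tail e
      · subst hs
        simp only [hin, hhe, hhe.symm, if_true, if_false] at this ⊢
        omega
      · have hs' : tail e ≠ s := fun h => hs h.symm
        simp only [hs, hs', if_false, eq_comm (a := head e) (b := s)] at this ⊢
        omega
    · intro h
      have h0 := h (tail e)
      simp only [hin, hhe, if_true, if_false] at h0
      refine ⟨by omega, fun s => ?_⟩
      have := h s
      by_cases hs : s = tail e
      · subst hs
        simp only [hin, hhe, hhe.symm, if_true, if_false] at this ⊢
        omega
      · have hs' : tail e ≠ s := fun h => hs h.symm
        simp only [hs, hs', if_false, eq_comm (a := head e) (b := s)] at this ⊢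
        omega

/-- The functions on the edges of a graph whose outflow at each vertex is covered by the supply and
the inflow. -/
def coveredFlows [Fintype E] (a : σ → ℕ) : Set (E → ℕ) :=
  {g | ∀ s, (∑ e, if tail e = s then g e else 0) ≤ a s + ∑ e, if head e = s then g e else 0}

/-- The number of covered flows on an acyclic graph is polynomial in the supply. -/
theorem exists_mvPolynomial_ncard_coveredFlows [DecidableEq E] [Fintype E] [LinearOrder σ]
    (h : ∀ e, tail e < head e) :
    (∀ a, (coveredFlows tail head a).Finite) ∧ ∃ P : MvPolynomial σ ℚ, ∀ a : σ → ℕ,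
      ((coveredFlows tail head a).ncard : ℚ) = MvPolynomial.eval (fun s => (a s : ℚ)) P := by
  let le : E → E → Bool := fun e e' => decide (tail e ≤ tail e')
  let L : List E := (Finset.univ : Finset E).toList.mergeSort le
  have hperm : L.Perm (Finset.univ : Finset E).toList := List.mergeSort_perm _ _
  have hnodup : L.Nodup := hperm.nodup_iff.2 (Finset.nodup_toList _)
  -- With edges sorted by tail, a later edge has its head strictly beyond the tail of any earlier
  -- one.
  have hpair : L.Pairwise fun e e' => head e' ≠ tail e := by
    refine (List.pairwise_mergeSort (le := le) ?_ ?_ _).imp ?_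
    · intro a b c h1 h2
      simp only [le, decide_eq_true_eq] at *
      exact h1.trans h2
    · intro a b
      simp only [le, Bool.or_eq_true, decide_eq_true_eq]
      exact le_total _ _
    · intro a b h1
      simp only [le, decide_eq_true_eq] at h1
      exact (h1.trans_lt (h b)).ne'
  have hsum : ∀ F : E → ℕ, (L.map F).sum = ∑ e, F e := fun F => by
    rw [(hperm.map F).sum_eq, Finset.sum_map_toList]
  have heq : ∀ a, coveredFlows tail head a = admissibleSet tail head L a := by
    intro a
    ext g
    rw [admissibleSet, Set.mem_ofPred_eq, admissible_iff tail head (fun e _ => (h e).ne') hpair]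
    simp only [hsum, coveredFlows, Set.mem_ofPred_eq]
    refine ⟨fun h => ⟨fun e he => absurd (hperm.mem_iff.2 (by simp)) he, h⟩, fun h => h.2⟩
  simp only [heq]
  exact ⟨admissibleSet_finite tail head hnodup,
    exists_mvPolynomial_ncard_admissibleSet tail head hnodup⟩

end Count

/-! ### Coordinates on a flow polytope -/

/-- The edges that start at height at least `k` and do not end in the sink. -/
abbrev InnerRoot (r k : ℕ) : Type := {β : PosRoot r // k ≤ (β.1.1 : ℕ) ∧ β.1.2 ≠ Fin.last r}

/-- The initial vertex of an inner edge. -/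
def InnerRoot.tail {r k : ℕ} (e : InnerRoot r k) : Fin (r + 1) := e.1.1.1

/-- The final vertex of an inner edge. -/
def InnerRoot.head {r k : ℕ} (e : InnerRoot r k) : Fin (r + 1) := e.1.1.2

theorem InnerRoot.tail_lt_head {r k : ℕ} (e : InnerRoot r k) : e.tail < e.head := e.1.2

/-- The flow out of a vertex along inner edges. -/
def innerOut {r k : ℕ} (i : Fin (r + 1)) : (InnerRoot r k → ℝ) →ₗ[ℝ] ℝ :=
  ∑ e : InnerRoot r k, if e.tail = i then LinearMap.proj e else 0

/-- The flow into a vertex along inner edges. -/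
def innerIn {r k : ℕ} (i : Fin (r + 1)) : (InnerRoot r k → ℝ) →ₗ[ℝ] ℝ :=
  ∑ e : InnerRoot r k, if e.head = i then LinearMap.proj e else 0

theorem innerOut_apply {r k : ℕ} (i : Fin (r + 1)) (g : InnerRoot r k → ℝ) :
    innerOut i g = ∑ e, if e.tail = i then g e else 0 := by
  rw [innerOut, LinearMap.sum_apply]
  exact Finset.sum_congr rfl fun e _ => by split_ifs <;> simp

theorem innerIn_apply {r k : ℕ} (i : Fin (r + 1)) (g : InnerRoot r k → ℝ) :
    innerIn i g = ∑ e, if e.head = i then g e else 0 := by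
  rw [innerIn, LinearMap.sum_apply]
  exact Finset.sum_congr rfl fun e _ => by split_ifs <;> simp

/-- The linear part of `completeFlow`. -/
def completeFlowLinear (r k : ℕ) : (InnerRoot r k → ℝ) →ₗ[ℝ] (PosRoot r → ℝ) :=
  LinearMap.pi fun β : PosRoot r =>
    if h : k ≤ (β.1.1 : ℕ) ∧ β.1.2 ≠ Fin.last r then LinearMap.proj (⟨β, h⟩ : InnerRoot r k)
    else if β.1.2 = Fin.last r then innerIn β.1.1 - innerOut β.1.1 else 0

/-- The flow with given values on the inner edges; the edges to the sink take the rest. -/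
def completeFlow {r : ℕ} (k : ℕ) (μ : Fin r → ℝ) : (InnerRoot r k → ℝ) →ᵃ[ℝ] (PosRoot r → ℝ) :=
  (completeFlowLinear r k).toAffineMap + AffineMap.const ℝ (InnerRoot r k → ℝ)
    (fun β : PosRoot r => if β.1.2 = Fin.last r then weight μ β.1.1 else 0)

/-- The values of a flow on the inner edges. -/
def innerPart {r : ℕ} (k : ℕ) (f : PosRoot r → ℝ) : InnerRoot r k → ℝ := fun e => f e.1

theorem completeFlow_inner {r k : ℕ} (μ : Fin r → ℝ) (g : InnerRoot r k → ℝ)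
    (e : InnerRoot r k) : completeFlow k μ g e.1 = g e := by
  change completeFlowLinear r k g e.1 + (if e.1.1.2 = Fin.last r then _ else _) = _
  rw [if_neg e.2.2, completeFlowLinear, LinearMap.pi_apply, dif_pos e.2]
  simp

theorem completeFlow_sink {r k : ℕ} (μ : Fin r → ℝ) (g : InnerRoot r k → ℝ) {β : PosRoot r}
    (h : β.1.2 = Fin.last r) :
    completeFlow k μ g β = weight μ β.1.1 + innerIn β.1.1 g - innerOut β.1.1 g := by
  change completeFlowLinear r k g β + (if β.1.2 = Fin.last r then _ else _) = _
  rw [if_pos h, completeFlowLinear, LinearMap.pi_apply, dif_neg fun h' => h'.2 h, if_pos h, LinearMap.sub_apply]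
  ring

theorem completeFlow_of_lt {r k : ℕ} (μ : Fin r → ℝ) (g : InnerRoot r k → ℝ) {β : PosRoot r}
    (h : β.1.2 ≠ Fin.last r) (hk : (β.1.1 : ℕ) < k) : completeFlow k μ g β = 0 := by
  change completeFlowLinear r k g β + (if β.1.2 = Fin.last r then _ else _) = _
  rw [if_neg h, completeFlowLinear, LinearMap.pi_apply, dif_neg fun h' => h'.1.not_gt hk, if_neg h]
  simp

theorem innerPart_completeFlow {r k : ℕ} (μ : Fin r → ℝ) (g : InnerRoot r k → ℝ) :
    innerPart k (completeFlow k μ g) = g :=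
  funext fun e => completeFlow_inner μ g e

theorem completeFlow_injective {r k : ℕ} (μ : Fin r → ℝ) :
    Function.Injective (completeFlow k μ) :=
  Function.LeftInverse.injective (innerPart_completeFlow μ)

theorem sum_innerRoot {r k : ℕ} (F : PosRoot r → ℝ) : ∑ e : InnerRoot r k, F e.1 =
    ∑ β : PosRoot r, if k ≤ (β.1.1 : ℕ) ∧ β.1.2 ≠ Fin.last r then F β else 0 := by
  rw [← Finset.sum_filter]
  exact (Finset.sum_subtype _ (by simp) F).symm

/-- The edge from `i` to the sink. -/
def sinkRoot {r : ℕ} (i : Fin r) : PosRoot r := ⟨(i.castSucc, Fin.last r), Fin.castSucc_lt_last i⟩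

theorem inflow_eq_innerIn {r k : ℕ} {f : PosRoot r → ℝ}
    (hf : ∀ β : PosRoot r, β.1.2 ≠ Fin.last r → (β.1.1 : ℕ) < k → f β = 0) (i : Fin r) :
    inflow f i.castSucc = innerIn i.castSucc (innerPart k f) := by
  rw [innerIn_apply, inflow]
  refine Eq.trans ?_ (sum_innerRoot fun β : PosRoot r => if β.1.2 = i.castSucc then f β else 0).symm
  refine Finset.sum_congr rfl fun β _ => ?_
  by_cases h : β.1.2 = i.castSucc
  · have hl : β.1.2 ≠ Fin.last r := by rw [h]; exact (Fin.castSucc_lt_last i).ne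
    by_cases hk : k ≤ (β.1.1 : ℕ)
    · rw [if_pos (show k ≤ (β.1.1 : ℕ) ∧ β.1.2 ≠ Fin.last r from ⟨hk, hl⟩)]
    · rw [hf β hl (not_le.1 hk)]
      simp
  · simp [h]

theorem outflow_eq_innerOut {r k : ℕ} {f : PosRoot r → ℝ}
    (hf : ∀ β : PosRoot r, β.1.2 ≠ Fin.last r → (β.1.1 : ℕ) < k → f β = 0) (i : Fin r) :
    outflow f i.castSucc = innerOut i.castSucc (innerPart k f) + f (sinkRoot i) := by
  have h1 : f (sinkRoot i) = ∑ β, if β = sinkRoot i then f β else 0 := by simp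
  have h2 : innerOut i.castSucc (innerPart k f) =
      ∑ β : PosRoot r, if k ≤ (β.1.1 : ℕ) ∧ β.1.2 ≠ Fin.last r then
        (if β.1.1 = i.castSucc then f β else 0) else 0 := by
    rw [innerOut_apply]
    exact sum_innerRoot fun β : PosRoot r => if β.1.1 = i.castSucc then f β else 0
  rw [h2, h1, ← Finset.sum_add_distrib, outflow]
  refine Finset.sum_congr rfl fun β _ => ?_
  by_cases h : β.1.1 = i.castSucc
  · by_cases hl : β.1.2 = Fin.last r
    · have : β = sinkRoot i := Subtype.ext (Prod.ext h hl)
      subst this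
      simp [sinkRoot]
    · have hne : β ≠ sinkRoot i := fun h' => hl (by rw [h']; rfl)
      by_cases hk : k ≤ (β.1.1 : ℕ)
      · rw [if_pos (show k ≤ (β.1.1 : ℕ) ∧ β.1.2 ≠ Fin.last r from ⟨hk, hl⟩), if_neg hne, add_zero]
      · rw [hf β hl (not_le.1 hk)]
        simp
  · have hne : β ≠ sinkRoot i := fun h' => h (by rw [h']; rfl)
    simp [h, hne]

theorem netflow_completeFlow {r k : ℕ} (μ : Fin r → ℝ) (g : InnerRoot r k → ℝ) (i : Fin (r + 1)) :
    outflow (completeFlow k μ g) i - inflow (completeFlow k μ g) i = weight μ i := by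
  have h : ∀ i : Fin r, outflow (completeFlow k μ g) i.castSucc -
      inflow (completeFlow k μ g) i.castSucc = weight μ i.castSucc := by
    intro i
    have hv := fun β : PosRoot r => completeFlow_of_lt μ g (β := β)
    rw [outflow_eq_innerOut hv, inflow_eq_innerIn hv, innerPart_completeFlow,
      completeFlow_sink μ g (β := sinkRoot i) rfl]
    simp only [sinkRoot]
    ring
  induction i using Fin.lastCases with
  | cast i => exact h i
  | last =>
    -- The equation at the sink follows from the others, as both sides have total zero.
    have h1 : ∑ i, (outflow (completeFlow k μ g) i - inflow (completeFlow k μ g) i) =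
        ∑ i, weight μ i := by
      rw [Finset.sum_sub_distrib, sum_outflow, sum_inflow, sum_weight, sub_self]
    rw [Fin.sum_univ_castSucc, Fin.sum_univ_castSucc, Finset.sum_congr rfl fun i _ => h i] at h1
    exact add_left_cancel h1

theorem completeFlow_innerPart {r k : ℕ} {μ : Fin r → ℝ} {f : PosRoot r → ℝ}
    (hf : ∀ β : PosRoot r, β.1.2 ≠ Fin.last r → (β.1.1 : ℕ) < k → f β = 0)
    (hnet : ∀ i, outflow f i - inflow f i = weight μ i) :
    completeFlow k μ (innerPart k f) = f := by
  funext β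
  by_cases hl : β.1.2 = Fin.last r
  · obtain ⟨i, hi⟩ := β.exists_castSucc
    have hβ : sinkRoot i = β := Subtype.ext (Prod.ext hi.symm hl.symm)
    have h := hnet i.castSucc
    rw [outflow_eq_innerOut hf, inflow_eq_innerIn hf, hβ] at h
    rw [completeFlow_sink _ _ hl, hi]
    linarith
  · by_cases hk : k ≤ (β.1.1 : ℕ)
    · exact completeFlow_inner μ (innerPart k f) ⟨β, hk, hl⟩
    · rw [completeFlow_of_lt _ _ hl (not_le.1 hk), hf β hl (not_le.1 hk)]

/-- The flow polytope in coordinates. -/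
def coordinatePolytope {r : ℕ} (k : ℕ) (μ : Fin r → ℝ) : Set (InnerRoot r k → ℝ) :=
  {g | (∀ e, 0 ≤ g e) ∧ ∀ i : Fin r, innerOut i.castSucc g ≤ μ i + innerIn i.castSucc g}

theorem completeFlow_mem_iff {r k : ℕ} {μ : Fin r → ℝ} {g : InnerRoot r k → ℝ} :
    completeFlow k μ g ∈ flowPolytope r (weight μ) ↔ g ∈ coordinatePolytope k μ := by
  rw [mem_flowPolytope_iff, and_iff_left (netflow_completeFlow μ g)]
  constructor
  · intro h
    refine ⟨fun e => ?_, fun i => ?_⟩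
    · rw [← completeFlow_inner μ g e]
      exact h _
    · have := h (sinkRoot i)
      rw [completeFlow_sink μ g (β := sinkRoot i) rfl] at this
      simp only [sinkRoot, weight_castSucc] at this
      linarith
  · rintro ⟨h1, h2⟩ β
    by_cases hl : β.1.2 = Fin.last r
    · obtain ⟨i, hi⟩ := β.exists_castSucc
      rw [completeFlow_sink _ _ hl, hi, weight_castSucc]
      linarith [h2 i]
    · by_cases hk : k ≤ (β.1.1 : ℕ)
      · rw [completeFlow_inner μ g ⟨β, hk, hl⟩]
        exact h1 _
      · rw [completeFlow_of_lt _ _ hl (not_le.1 hk)]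

theorem eq_zero_of_mem_flowPolytope {r k : ℕ} {μ : Fin r → ℝ}
    (hk : ∀ i : Fin r, (i : ℕ) < k → μ i = 0) {f : PosRoot r → ℝ}
    (hf : f ∈ flowPolytope r (weight μ)) (β : PosRoot r) (hβ : (β.1.1 : ℕ) < k) : f β = 0 := by
  rw [mem_flowPolytope_iff] at hf
  suffices ∀ i : Fin (r + 1), (i : ℕ) < k → ∀ β : PosRoot r, β.1.1 = i → f β = 0 from
    this _ hβ β rfl
  intro i
  induction i using WellFoundedLT.induction with
  | _ i ih =>
    intro hi β hβ
    obtain ⟨j, rfl⟩ : ∃ j : Fin r, i = j.castSucc := hβ ▸ β.exists_castSucc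
    have hin : inflow f j.castSucc = 0 := by
      refine Finset.sum_eq_zero fun γ _ => ?_
      split_ifs with hγ
      · have : γ.1.1 < j.castSucc := hγ ▸ γ.2
        exact ih _ this (lt_trans this hi) γ rfl
      · rfl
    have hout := hf.2 j.castSucc
    rw [hin, weight_castSucc, hk j hi, sub_zero, outflow, Finset.sum_eq_zero_iff_of_nonneg] at hout
    · have := hout β (Finset.mem_univ _)
      rwa [if_pos hβ] at this
    · intro γ _
      split_ifs
      exacts [hf.1 γ, le_rfl]

theorem image_completeFlow {r k : ℕ} {μ : Fin r → ℝ}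
    (hk : ∀ i : Fin r, (i : ℕ) < k → μ i = 0) :
    completeFlow k μ '' coordinatePolytope k μ = flowPolytope r (weight μ) := by
  refine Set.Subset.antisymm ?_ fun f hf => ?_
  · rintro _ ⟨g, hg, rfl⟩
    exact completeFlow_mem_iff.2 hg
  · have h := completeFlow_innerPart (fun β _ => eq_zero_of_mem_flowPolytope hk hf β)
      (mem_flowPolytope_iff.1 hf).2
    exact ⟨innerPart k f, completeFlow_mem_iff.1 (by rwa [h]), h⟩

theorem preimage_completeFlow {r k : ℕ} (μ : Fin r → ℝ) :
    completeFlow k μ ⁻¹' flowPolytope r (weight μ) = coordinatePolytope k μ :=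
  Set.ext fun _ => completeFlow_mem_iff

theorem weight_integral {r : ℕ} {μ : Fin r → ℝ} (hμ : μ ∈ integralPoints (Fin r)) :
    weight μ ∈ integralPoints (Fin (r + 1)) := by
  intro i
  induction i using Fin.lastCases with
  | cast i => rw [weight_castSucc]; exact hμ i
  | last =>
    obtain ⟨z, hz⟩ := exists_int_sum Finset.univ fun i _ => hμ i
    exact ⟨-z, by rw [weight_last, hz]; push_cast; rfl⟩

theorem completeFlow_integral {r k : ℕ} {μ : Fin r → ℝ} (hμ : μ ∈ integralPoints (Fin r))
    {g : InnerRoot r k → ℝ} (hg : g ∈ integralPoints (InnerRoot r k)) :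
    completeFlow k μ g ∈ integralPoints (PosRoot r) := by
  intro β
  by_cases hl : β.1.2 = Fin.last r
  · rw [completeFlow_sink _ _ hl, innerIn_apply, innerOut_apply]
    exact exists_int_sub (exists_int_add (weight_integral hμ _)
      (exists_int_sum _ fun e _ => exists_int_ite _ fun _ => hg e))
      (exists_int_sum _ fun e _ => exists_int_ite _ fun _ => hg e)
  · by_cases hk : k ≤ (β.1.1 : ℕ)
    · rw [completeFlow_inner μ g ⟨β, hk, hl⟩]
      exact hg _
    · exact ⟨0, by rw [completeFlow_of_lt _ _ hl (not_le.1 hk)]; simp⟩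

theorem image_completeFlow_integral_inter {r k : ℕ} {μ : Fin r → ℝ}
    (hμ : μ ∈ integralPoints (Fin r)) (A : Set (InnerRoot r k → ℝ)) :
    completeFlow k μ '' (integralPoints (InnerRoot r k) ∩ A) =
      integralPoints (PosRoot r) ∩ completeFlow k μ '' A := by
  ext f
  constructor
  · rintro ⟨g, ⟨hg, hA⟩, rfl⟩
    exact ⟨completeFlow_integral hμ hg, g, hA, rfl⟩
  · rintro ⟨hf, g, hA, rfl⟩
    refine ⟨g, ⟨fun e => ?_, hA⟩, rfl⟩
    rw [← completeFlow_inner μ g e]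
    exact hf e.1

theorem isCompact_coordinatePolytope {r k : ℕ} (μ : Fin r → ℝ) :
    IsCompact (coordinatePolytope k μ) := by
  have hcl : IsClosed (coordinatePolytope k μ) := by
    rw [← preimage_completeFlow]
    exact (isClosed_flowPolytope _).preimage (AffineMap.continuous_of_finiteDimensional _)
  refine (isCompact_univ_pi fun _ : InnerRoot r k => isCompact_Icc (a := (0 : ℝ))
    (b := -∑ i : Fin (r + 1), (i : ℝ) * weight μ i)).of_isClosed_subset
    hcl fun g hg e _ => ⟨hg.1 e, ?_⟩
  rw [← completeFlow_inner μ g e]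
  exact apply_le_of_mem_flowPolytope (completeFlow_mem_iff.2 hg) e.1

theorem convex_coordinatePolytope {r k : ℕ} (μ : Fin r → ℝ) :
    Convex ℝ (coordinatePolytope k μ) := by
  rw [← preimage_completeFlow]
  exact (convex_flowPolytope _).affine_preimage _

/-- Let the flow on an edge decay geometrically with its tail: the edge from `i - 1` to `i` alone
then brings more than all inner edges out of `i` take, and `1 ≤ μ k` starts the chain. -/
theorem interior_coordinatePolytope_nonempty {r k : ℕ} {μ : Fin r → ℝ} (hμ : ∀ i, 0 ≤ μ i)
    (hk : ∀ i : Fin r, (i : ℕ) = k → 1 ≤ μ i) :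
    (interior (coordinatePolytope k μ)).Nonempty := by
  -- Vertices before `k` are omitted: their inequalities hold automatically but may be equalities.
  let U : Set (InnerRoot r k → ℝ) := (⋂ e, {g | 0 < g e}) ∩ ⋂ i : Fin r, ⋂ _ : k ≤ (i : ℕ),
    {g | innerOut i.castSucc g < μ i + innerIn i.castSucc g}
  have hU : IsOpen U := by
    refine (isOpen_iInter_of_finite fun e => isOpen_lt continuous_const
      (continuous_apply e)).inter (isOpen_iInter_of_finite fun i => isOpen_iInter_of_finite fun _ =>
        isOpen_lt ?_ (continuous_const.add ?_))
    · exact LinearMap.continuous_of_finiteDimensional _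
    · exact LinearMap.continuous_of_finiteDimensional _
  have hsub : U ⊆ coordinatePolytope k μ := by
    rintro g ⟨h1, h2⟩
    simp only [Set.mem_iInter, Set.mem_ofPred_eq] at h1 h2
    refine ⟨fun e => (h1 e).le, fun i => ?_⟩
    by_cases hi : k ≤ (i : ℕ)
    · exact (h2 i hi).le
    · have hout : innerOut i.castSucc g = 0 := by
        rw [innerOut_apply]
        refine Finset.sum_eq_zero fun e _ => if_neg fun h => hi ?_
        have := e.2.1
        rwa [show e.1.1.1 = i.castSucc from h] at this
      have hin : 0 ≤ innerIn i.castSucc g := by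
        rw [innerIn_apply]
        refine Finset.sum_nonneg fun e _ => ?_
        split_ifs
        exacts [(h1 e).le, le_rfl]
      rw [hout]
      exact add_nonneg (hμ i) hin
  -- With fewer than `N` edges out of `i`, each carrying `N⁻¹ ^ (i + 1)`, the outflow stays below
  -- `N⁻¹ ^ i`.
  let N : ℝ := Fintype.card (InnerRoot r k) + 1
  have hN : 1 ≤ N := by simp [N]
  have hN0 : 0 < N := by linarith
  let g : InnerRoot r k → ℝ := fun e => (N ^ ((e.tail : ℕ) + 1))⁻¹
  have hg : ∀ e, 0 < g e := fun e => by positivity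
  refine ⟨g, interior_maximal hsub hU ⟨by simpa using hg, ?_⟩⟩
  simp only [Set.mem_iInter, Set.mem_ofPred_eq]
  intro i hi
  have hout : innerOut i.castSucc g < (N ^ (i : ℕ))⁻¹ := by
    have h1 : innerOut i.castSucc g ≤
        ∑ _e : InnerRoot r k, (N ^ ((i : ℕ) + 1))⁻¹ := by
      rw [innerOut_apply]
      refine Finset.sum_le_sum fun e _ => ?_
      split_ifs with h
      · simp [g, h]
      · positivity
    rw [Finset.sum_const, Finset.card_univ, nsmul_eq_mul] at h1
    refine h1.trans_lt ?_
    have h2 : (N ^ (i : ℕ))⁻¹ = N * (N ^ ((i : ℕ) + 1))⁻¹ := by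
      rw [pow_succ]
      field_simp
    rw [h2]
    exact mul_lt_mul_of_pos_right (by simp [N]) (by positivity)
  have hin0 : 0 ≤ innerIn i.castSucc g := by
    rw [innerIn_apply]
    refine Finset.sum_nonneg fun e _ => ?_
    split_ifs
    exacts [(hg e).le, le_rfl]
  rcases hi.eq_or_lt with h | h
  · have h1 := hk i h.symm
    have h2 : (N ^ (i : ℕ))⁻¹ ≤ 1 := inv_le_one_of_one_le₀ (one_le_pow₀ hN)
    linarith
  · let e : InnerRoot r k := ⟨⟨(⟨i - 1, by omega⟩, i.castSucc), by simp [Fin.lt_def]; omega⟩,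
      by simp; omega, (Fin.castSucc_lt_last i).ne⟩
    have h1 : (N ^ (i : ℕ))⁻¹ ≤ innerIn i.castSucc g := by
      rw [innerIn_apply]
      have h3 : (N ^ (i : ℕ))⁻¹ = if e.head = i.castSucc then g e else 0 := by
        rw [if_pos (show e.head = i.castSucc from rfl)]
        simp only [g]
        congr 2
        simp only [InnerRoot.tail, e]
        omega
      rw [h3]
      refine Finset.single_le_sum (f := fun e : InnerRoot r k =>
        if e.head = i.castSucc then g e else 0) (fun e _ => ?_) (Finset.mem_univ e)
      split_ifs
      exacts [(hg e).le, le_rfl]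
    linarith [hμ i]

/-- In coordinates the polytope has interior, so it spans everything. The choice of `k` matters:
coordinates with earlier tails would vanish identically on the polytope. -/
theorem affineSpan_flowPolytope {r k : ℕ} {μ : Fin r → ℝ} (hμ : ∀ i, 0 ≤ μ i)
    (h0 : ∀ i : Fin r, (i : ℕ) < k → μ i = 0) (hk : ∀ i : Fin r, (i : ℕ) = k → 1 ≤ μ i) :
    (affineSpan ℝ (flowPolytope r (weight μ)) : Set (PosRoot r → ℝ)) =
      Set.range (completeFlow k μ) := by
  have htop : affineSpan ℝ (coordinatePolytope k μ) = ⊤ := by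
    have h1 := isOpen_interior.affineSpan_eq_top (interior_coordinatePolytope_nonempty hμ hk)
    rw [eq_top_iff, ← h1]
    exact affineSpan_mono ℝ interior_subset
  rw [← image_completeFlow h0, ← AffineSubspace.map_span, htop]
  simp

/-! ### Lattice points -/

/-- The supply at each vertex, zero at the sink. -/
def supply {r : ℕ} (μ : Fin r → ℕ) : Fin (r + 1) → ℕ := Fin.snoc (α := fun _ => ℕ) μ 0

theorem supply_mul {r : ℕ} (t : ℕ) (μ : Fin r → ℕ) :
    supply (fun i => t * μ i) = fun i => t * supply μ i := by
  funext i
  induction i using Fin.lastCases <;> simp [supply]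

theorem mem_coveredFlows_supply {r k : ℕ} {μ : Fin r → ℕ} {g : InnerRoot r k → ℕ} :
    g ∈ coveredFlows InnerRoot.tail InnerRoot.head (supply μ) ↔
      (fun e => (g e : ℝ)) ∈ coordinatePolytope k fun i => (μ i : ℝ) := by
  have hcast : ∀ (φ : InnerRoot r k → Fin (r + 1)) i, (∑ e, if φ e = i then (g e : ℝ) else 0) =
      ((∑ e, if φ e = i then g e else 0 : ℕ) : ℝ) := fun φ i => by push_cast; rfl
  simp only [coveredFlows, coordinatePolytope, Set.mem_ofPred_eq, innerOut_apply, innerIn_apply,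
    hcast]
  constructor
  · intro h
    refine ⟨fun e => Nat.cast_nonneg _, fun i => ?_⟩
    have := h i.castSucc
    simp only [supply, Fin.snoc_castSucc] at this
    exact_mod_cast this
  · rintro ⟨-, h⟩ i
    induction i using Fin.lastCases with
    | last =>
      rw [Finset.sum_eq_zero fun e _ => if_neg
        ((InnerRoot.tail_lt_head e).trans_le (Fin.le_last _)).ne]
      exact Nat.zero_le _
    | cast i =>
      simp only [supply, Fin.snoc_castSucc]
      exact_mod_cast h i

theorem image_cast_coveredFlows {r : ℕ} (k : ℕ) (μ : Fin r → ℕ) :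
    (fun (g : InnerRoot r k → ℕ) e => (g e : ℝ)) ''
      coveredFlows InnerRoot.tail InnerRoot.head (supply μ) =
    integralPoints (InnerRoot r k) ∩ coordinatePolytope k fun i => (μ i : ℝ) := by
  ext x
  constructor
  · rintro ⟨g, hg, rfl⟩
    exact ⟨fun e => ⟨g e, by simp⟩, mem_coveredFlows_supply.1 hg⟩
  · rintro ⟨hint, hx⟩
    have : ∀ e, ∃ n : ℕ, x e = n := fun e => by
      obtain ⟨z, hz⟩ := hint e
      have h0 := hx.1 e
      rw [hz] at h0
      lift z to ℕ using by exact_mod_cast h0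
      exact ⟨z, by simpa using hz⟩
    choose g hg using this
    obtain rfl : x = fun e => (g e : ℝ) := funext hg
    exact ⟨g, mem_coveredFlows_supply.2 hx, rfl⟩

theorem smul_mem_coordinatePolytope {r k : ℕ} {μ : Fin r → ℝ} {t : ℝ} (ht : 0 < t)
    {g : InnerRoot r k → ℝ} :
    t • g ∈ coordinatePolytope k (fun i => t * μ i) ↔ g ∈ coordinatePolytope k μ := by
  simp only [coordinatePolytope, Set.mem_ofPred_eq, Pi.smul_apply, smul_eq_mul, map_smul,
    ← mul_add]
  simp [ht, mul_le_mul_iff_right₀]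

open Pointwise in
theorem ncard_coordinatePolytope_inter {r : ℕ} (k : ℕ) (μ : Fin r → ℕ) {t : ℕ} (ht : 1 ≤ t) :
    ((coordinatePolytope k fun i => (μ i : ℝ)) ∩
      (t : ℝ)⁻¹ • integralPoints (InnerRoot r k)).ncard =
    (coveredFlows (InnerRoot.tail (k := k)) InnerRoot.head (supply fun i => t * μ i)).ncard := by
  have ht0 : (0 : ℝ) < t := by exact_mod_cast ht
  have hinj : Function.Injective fun (g : InnerRoot r k → ℕ) e => (g e : ℝ) :=
    fun g g' h => funext fun e => Nat.cast_injective (congrFun h e)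
  rw [← Set.ncard_image_of_injective _ hinj, image_cast_coveredFlows,
    ← Set.ncard_image_of_injective _ (smul_right_injective (InnerRoot r k → ℝ) ht0.ne')]
  congr 1
  ext x
  simp only [Set.mem_image, Set.mem_inter_iff, Nat.cast_mul]
  constructor
  · rintro ⟨y, ⟨hy, z, hz, rfl⟩, rfl⟩
    refine ⟨?_, (smul_mem_coordinatePolytope ht0).2 hy⟩
    simpa [smul_smul, ht0.ne'] using hz
  · rintro ⟨hx, hx'⟩
    refine ⟨(t : ℝ)⁻¹ • x, ⟨?_, Set.smul_mem_smul_set hx⟩, by simp [smul_smul, ht0.ne']⟩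
    rw [← smul_mem_coordinatePolytope ht0]
    simpa [smul_smul, ht0.ne'] using hx'

/-! ### Lattice charts and relative volume -/

section Charts

variable {V : Type*} [AddCommGroup V] [Module ℝ V]

theorem exists_int_det {d : ℕ} (A : (Fin d → ℝ) →ₗ[ℝ] (Fin d → ℝ))
    (hA : ∀ x ∈ integralPoints (Fin d), A x ∈ integralPoints (Fin d)) :
    ∃ z : ℤ, LinearMap.det A = z := by
  have h : ∀ i j, ∃ z : ℤ, LinearMap.toMatrix' A i j = z := by
    intro i j
    rw [LinearMap.toMatrix'_apply]
    refine hA _ (fun k => ?_) i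
    by_cases hk : k = j
    · exact ⟨1, by simp [hk]⟩
    · exact ⟨0, by simp [hk]⟩
  choose M hM using h
  refine ⟨Matrix.det (Matrix.of M), ?_⟩
  have : LinearMap.toMatrix' A = (Matrix.of M).map (fun z : ℤ => (z : ℝ)) := by
    ext i j
    simp [hM]
  rw [← LinearMap.det_toMatrix', this, Int.cast_det]

theorem direction_of_range_eq {ι : Type*} {P : Set V} {φ : (ι → ℝ) →ᵃ[ℝ] V}
    (h : Set.range φ = affineSpan ℝ P) : (affineSpan ℝ P).direction = φ.linear.range := by
  have : affineSpan ℝ P = AffineSubspace.map φ ⊤ := by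
    apply SetLike.coe_injective
    rw [← h]
    simp
  rw [this, AffineSubspace.map_direction, AffineSubspace.direction_top, Submodule.map_top]

theorem IsLatticeChart.polytopeDim_eq {L P : Set V} {d : ℕ} {φ : (Fin d → ℝ) →ᵃ[ℝ] V}
    (h : IsLatticeChart L P φ) : polytopeDim P = d := by
  rw [polytopeDim, direction_of_range_eq h.2.1,
    LinearMap.finrank_range_of_inj ((AffineMap.linear_injective_iff φ).2 h.1)]
  simp

/-- The transition map between two lattice charts. -/
theorem IsLatticeChart.exists_transition {L P : Set V} {d : ℕ} {φ ψ : (Fin d → ℝ) →ᵃ[ℝ] V}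
    (hφ : IsLatticeChart L P φ) (hψ : IsLatticeChart L P ψ) :
    ∃ (A : (Fin d → ℝ) →ₗ[ℝ] (Fin d → ℝ)) (c : Fin d → ℝ), (∀ x, φ (A x + c) = ψ x) ∧
      ∀ x ∈ integralPoints (Fin d), A x ∈ integralPoints (Fin d) := by
  obtain ⟨g, hg⟩ := φ.linear.exists_leftInverse_of_injective
    (LinearMap.ker_eq_bot.2 ((AffineMap.linear_injective_iff φ).2 hφ.1))
  have hgφ : ∀ y, g (φ y - φ 0) = y := by
    intro y
    have h1 : φ y - φ 0 = φ.linear y := by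
      have := φ.linearMap_vsub y 0
      simpa using this.symm
    rw [h1]
    exact LinearMap.congr_fun hg y
  have hT : ∀ x, g (ψ x - φ 0) = g.comp ψ.linear x + g (ψ 0 - φ 0) := by
    intro x
    have h1 : ψ x - ψ 0 = ψ.linear x := by
      have := ψ.linearMap_vsub x 0
      simpa using this.symm
    rw [LinearMap.comp_apply, ← map_add, ← h1]
    congr 1
    abel
  have hint : ∀ x ∈ integralPoints (Fin d), g (ψ x - φ 0) ∈ integralPoints (Fin d) := by
    intro x hx
    have : ψ x ∈ φ '' integralPoints (Fin d) := by
      rw [hφ.2.2, ← hψ.2.2]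
      exact ⟨x, hx, rfl⟩
    obtain ⟨y, hy, hxy⟩ := this
    rw [← hxy, hgφ]
    exact hy
  refine ⟨g.comp ψ.linear, g (ψ 0 - φ 0), fun x => ?_, fun x hx i => ?_⟩
  · have : ψ x ∈ Set.range φ := by
      rw [hφ.2.1, ← hψ.2.1]
      exact ⟨x, rfl⟩
    obtain ⟨y, hy⟩ := this
    rw [← hT, ← hy, hgφ]
  -- The linear part at `x` is the difference of the integral values of the transition at `x` and at
  -- 0.
  · obtain ⟨a, ha⟩ := hint x hx i
    obtain ⟨b, hb⟩ := hint 0 (fun _ => ⟨0, by simp⟩) i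
    refine ⟨a - b, ?_⟩
    have h1 := congrFun (hT x) i
    rw [Pi.add_apply, ha, hb] at h1
    push_cast
    exact eq_sub_of_add_eq h1.symm

/-- The linear parts of the two transition maps are mutually inverse and integral, so their
determinants are integers with product 1, that is `±1`. -/
theorem IsLatticeChart.volume_preimage_eq {L P : Set V} {d : ℕ} {φ ψ : (Fin d → ℝ) →ᵃ[ℝ] V}
    (hφ : IsLatticeChart L P φ) (hψ : IsLatticeChart L P ψ) :
    MeasureTheory.volume (ψ ⁻¹' P) = MeasureTheory.volume (φ ⁻¹' P) := by
  obtain ⟨A, c, hA, hAint⟩ := hφ.exists_transition hψ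
  obtain ⟨B, b, hB, hBint⟩ := hψ.exists_transition hφ
  have hAB : A.comp B = LinearMap.id := by
    have h : ∀ x, A (B x + b) + c = x := fun x => hφ.1 (by rw [hA, hB])
    refine LinearMap.ext fun x => ?_
    have h1 := h x
    have h0 := h 0
    rw [map_add] at h1 h0
    rw [map_zero, map_zero, zero_add] at h0
    rw [add_assoc, h0, add_zero] at h1
    exact h1
  have hdet : LinearMap.det A * LinearMap.det B = 1 := by
    rw [← LinearMap.det_comp, hAB, LinearMap.det_id]
  obtain ⟨m, hm⟩ := exists_int_det A hAint
  obtain ⟨n, hn⟩ := exists_int_det B hBint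
  have hmn : m * n = 1 := by
    rw [hm, hn] at hdet
    exact_mod_cast hdet
  have habs : |LinearMap.det A| = 1 := by
    rw [hm]
    exact_mod_cast Int.isUnit_iff_abs_eq.1 (IsUnit.of_mul_eq_one n hmn)
  have hne : LinearMap.det A ≠ 0 := left_ne_zero_of_mul_eq_one hdet
  have : ψ ⁻¹' P = A ⁻¹' ((fun x => x + c) ⁻¹' (φ ⁻¹' P)) := by
    ext x
    simp only [Set.mem_preimage, hA]
  rw [this, MeasureTheory.Measure.addHaar_preimage_linearMap _ hne, abs_inv, habs,
    MeasureTheory.measure_preimage_add_right]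
  simp

/-- A chart with coordinates in any finite type determines dimension and relative volume. -/
theorem hasRelativeVolume_of_chart {ι : Type*} [Fintype ι] {L P : Set V} {χ : (ι → ℝ) →ᵃ[ℝ] V}
    (hinj : Function.Injective χ) (hrange : Set.range χ = affineSpan ℝ P)
    (hint : χ '' integralPoints ι = L ∩ affineSpan ℝ P) :
    polytopeDim P = Fintype.card ι ∧ HasRelativeVolume L P (MeasureTheory.volume (χ ⁻¹' P)) := by
  let e : Fin (Fintype.card ι) ≃ ι := (Fintype.equivFin ι).symm
  let ℓ := LinearEquiv.funCongrLeft ℝ ℝ e.symm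
  let φ : (Fin (Fintype.card ι) → ℝ) →ᵃ[ℝ] V := χ.comp ℓ.toLinearMap.toAffineMap
  have hφ : ∀ x, φ x = χ (ℓ x) := fun _ => rfl
  have hchart : IsLatticeChart L P φ := by
    refine ⟨fun x y h => ℓ.injective (hinj h), ?_, ?_⟩
    · rw [← hrange]
      ext v
      constructor
      · rintro ⟨x, rfl⟩
        exact ⟨ℓ x, rfl⟩
      · rintro ⟨x, rfl⟩
        exact ⟨ℓ.symm x, by rw [hφ, LinearEquiv.apply_symm_apply]⟩
    · rw [← hint]
      ext v
      constructor
      · rintro ⟨x, hx, rfl⟩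
        exact ⟨ℓ x, fun i => hx (e.symm i), rfl⟩
      · rintro ⟨x, hx, rfl⟩
        exact ⟨ℓ.symm x, fun i => hx (e i), by rw [hφ, LinearEquiv.apply_symm_apply]⟩
  have hvol : MeasureTheory.volume (φ ⁻¹' P) = MeasureTheory.volume (χ ⁻¹' P) :=
    (MeasureTheory.volume_measurePreserving_piCongrLeft (fun _ : ι => ℝ)
      e).measure_preimage_equiv (χ ⁻¹' P) |>.symm ▸ by
        congr 1
        ext x
        have : (MeasurableEquiv.piCongrLeft (fun _ : ι => ℝ) e) x = ℓ x := by
          funext i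
          obtain ⟨j, rfl⟩ := e.surjective i
          rw [MeasurableEquiv.coe_piCongrLeft, Equiv.piCongrLeft_apply_apply]
          simp [ℓ, LinearMap.funLeft]
        simp only [Set.mem_preimage, this, hφ]
  refine ⟨hchart.polytopeDim_eq, ⟨_, φ, hchart⟩, fun d ψ hψ => ?_⟩
  obtain rfl : d = Fintype.card ι := by rw [← hψ.polytopeDim_eq, hchart.polytopeDim_eq]
  rw [hchart.volume_preimage_eq hψ, hvol]

end Charts

/-! ### Counting lattice points in dilates -/

theorem coe_span_basisFun (ι : Type*) [Fintype ι] :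
    (Submodule.span ℤ (Set.range (Pi.basisFun ℝ ι)) : Set (ι → ℝ)) = integralPoints ι := by
  ext x
  rw [SetLike.mem_coe, Module.Basis.mem_span_iff_repr_mem]
  simp [integralPoints, eq_comm]

open Filter Topology in
-- A smaller degree would force the limit 0, and a larger one divergence.
theorem natDegree_eq_of_tendsto {p : Polynomial ℝ} {d : ℕ} {v : ℝ} (hv : 0 < v)
    (h : Tendsto (fun n : ℕ => p.eval (n : ℝ) / (n : ℝ) ^ d) atTop (𝓝 v)) :
    p.natDegree = d ∧ p.leadingCoeff = v := by
  have hX : ∀ x : ℝ, (Polynomial.X ^ d : Polynomial ℝ).eval x = x ^ d := fun x => by simp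
  have hdX : (Polynomial.X ^ d : Polynomial ℝ).degree = d := Polynomial.degree_X_pow d
  rcases lt_trichotomy p.degree (d : WithBot ℕ) with hlt | heq | hgt
  · have h1 := Polynomial.div_tendsto_atTop_zero_of_degree_lt p (Polynomial.X ^ d) (by rwa [hdX])
    simp only [hX] at h1
    exact absurd (tendsto_nhds_unique h (h1.comp tendsto_natCast_atTop_atTop)) hv.ne'
  · have h1 := Polynomial.div_tendsto_atTop_leadingCoeff_div_of_degree_eq p (Polynomial.X ^ d)
      (by rwa [hdX])
    simp only [hX, Polynomial.leadingCoeff_X_pow, div_one] at h1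
    exact ⟨Polynomial.natDegree_eq_of_degree_eq_some heq,
      (tendsto_nhds_unique h (h1.comp tendsto_natCast_atTop_atTop)).symm⟩
  · have h1 := Polynomial.abs_div_tendsto_atTop_atTop_of_degree_gt p (Polynomial.X ^ d)
      (by rwa [hdX]) (pow_ne_zero _ Polynomial.X_ne_zero)
    simp only [hX] at h1
    exact absurd h.abs (not_tendsto_nhds_of_tendsto_atTop (h1.comp tendsto_natCast_atTop_atTop) _)

open Filter Topology Pointwise in
/-- If the number of lattice points in the dilates of a convex body is a polynomial, its degree is
the dimension and its leading coefficient the volume. -/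
theorem natDegree_eq_and_volume_eq {ι : Type*} [Fintype ι] {Q : Set (ι → ℝ)} (hc : IsCompact Q)
    (hconv : Convex ℝ Q) (hint : (interior Q).Nonempty) {p : Polynomial ℚ}
    (hp : ∀ t : ℕ, 1 ≤ t → ((Q ∩ (t : ℝ)⁻¹ • integralPoints ι).ncard : ℚ) = p.eval (t : ℚ)) :
    p.natDegree = Fintype.card ι ∧
      MeasureTheory.volume Q = ENNReal.ofReal (p.leadingCoeff : ℝ) := by
  -- Convexity enters through the frontier, which is a null set.
  have h := tendsto_card_div_pow_atTop_volume Q hc.isBounded hc.measurableSet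
    (hconv.addHaar_frontier _)
  have hfin : MeasureTheory.volume Q ≠ ⊤ := hc.measure_lt_top.ne
  have hpos : 0 < MeasureTheory.volume.real Q :=
    ENNReal.toReal_pos (MeasureTheory.Measure.measure_pos_of_nonempty_interior _ hint).ne' hfin
  have h2 : Tendsto (fun n : ℕ => (p.map (algebraMap ℚ ℝ)).eval (n : ℝ) /
      (n : ℝ) ^ Fintype.card ι) atTop (𝓝 (MeasureTheory.volume.real Q)) := by
    refine h.congr' ((eventually_ge_atTop 1).mono fun t ht => ?_)
    have h3 : (p.map (algebraMap ℚ ℝ)).eval (t : ℝ) = ((p.eval (t : ℚ) : ℚ) : ℝ) := by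
      have := Polynomial.eval_map_apply (f := algebraMap ℚ ℝ) (p := p) (t : ℚ)
      simpa using this
    beta_reduce
    rw [h3, ← hp t ht, coe_span_basisFun, Nat.card_coe_set_eq]
    simp
  obtain ⟨h3, h4⟩ := natDegree_eq_of_tendsto hpos h2
  refine ⟨by simpa using h3, ?_⟩
  rw [← ENNReal.ofReal_toReal hfin]
  change ENNReal.ofReal (MeasureTheory.volume.real Q) = _
  rw [← h4]
  simp

/-! ### Assembly: juggling counts, the Ehrhart polynomial and integral equivalence -/

theorem integralPoints_natCast {ι : Type*} (μ : ι → ℕ) :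
    (fun i => (μ i : ℝ)) ∈ integralPoints ι := fun i => ⟨μ i, by simp⟩

/-- Juggling sequences correspond to the covered flows on the inner edges. -/
theorem image_castSequence_JS_eq_image_coveredFlows {r k : ℕ} {μ : Fin r → ℕ}
    (hk : ∀ i : Fin r, (i : ℕ) < k → μ i = 0) :
    castSequence '' JS (state μ) (state ![∑ i, μ i]) r =
      (fun g : InnerRoot r k → ℕ => flowToSequence (fun i => (μ i : ℝ))
        (completeFlow k (fun i => (μ i : ℝ)) fun e => (g e : ℝ))) ''
        coveredFlows InnerRoot.tail InnerRoot.head (supply μ) := by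
  have hint := integralPoints_natCast μ
  rw [image_castSequence_JS μ _ rfl, ← image_flowToSequence fun i => Nat.cast_nonneg (μ i),
    ← image_flowToSequence_integral_inter hint,
    ← image_completeFlow (k := k) (fun i hi => by simp [hk i hi]),
    ← image_completeFlow_integral_inter hint, ← image_cast_coveredFlows, Set.image_image,
    Set.image_image]

theorem finite_JS_and_js_eq {r k : ℕ} {μ : Fin r → ℕ}
    (hk : ∀ i : Fin r, (i : ℕ) < k → μ i = 0) :
    (JS (state μ) (state ![∑ i, μ i]) r).Finite ∧ js (state μ) (state ![∑ i, μ i]) r =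
      (coveredFlows (InnerRoot.tail (r := r) (k := k)) InnerRoot.head (supply μ)).ncard := by
  have h := image_castSequence_JS_eq_image_coveredFlows hk
  have hinj : Function.Injective fun g : InnerRoot r k → ℕ =>
      flowToSequence (fun i => (μ i : ℝ))
        (completeFlow k (fun i => (μ i : ℝ)) fun e => (g e : ℝ)) := fun g g' hg =>
    funext fun e => Nat.cast_injective (R := ℝ)
      (congrFun (completeFlow_injective _ (flowToSequence_injective _ hg)) e)
  have hfin := (exists_mvPolynomial_ncard_coveredFlows (InnerRoot.tail (r := r) (k := k))
    InnerRoot.head InnerRoot.tail_lt_head).1 (supply μ)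
  refine ⟨Set.Finite.of_finite_image (h ▸ hfin.image _) castSequence_injective.injOn, ?_⟩
  rw [js, ← Set.ncard_image_of_injective _ castSequence_injective, h,
    Set.ncard_image_of_injective _ hinj]

theorem exists_first_nonzero {r : ℕ} (μ : Fin r → ℕ) :
    ∃ k : ℕ, (∀ i : Fin r, (i : ℕ) < k → μ i = 0) ∧ ∀ i : Fin r, (i : ℕ) = k → 1 ≤ μ i := by
  by_cases h : ∃ k : ℕ, ∃ i : Fin r, (i : ℕ) = k ∧ μ i ≠ 0
  · classical
    refine ⟨Nat.find h, fun i hi => ?_, fun i hi => ?_⟩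
    · by_contra h0
      exact Nat.find_min h hi ⟨i, rfl, h0⟩
    · obtain ⟨j, hj, hj0⟩ := Nat.find_spec h
      obtain rfl : i = j := Fin.ext (hi.trans hj.symm)
      exact Nat.one_le_iff_ne_zero.2 hj0
  -- If `μ = 0`, then `k = r` leaves no inner edges, and the polytope is a point.
  · refine ⟨r, fun i _ => ?_, fun i hi => absurd hi i.2.ne⟩
    by_contra h0
    exact h ⟨i, i, rfl, h0⟩

theorem coe_affineSpan_image {V W : Type*} [AddCommGroup V] [Module ℝ V] [AddCommGroup W]
    [Module ℝ W] (φ : V →ᵃ[ℝ] W) (P : Set V) :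
    (affineSpan ℝ (φ '' P) : Set W) = φ '' affineSpan ℝ P := by
  rw [← AffineSubspace.map_span, AffineSubspace.coe_map]

theorem exists_ehrhart_polynomial {r : ℕ} (μ : Fin r → ℕ) :
    ∃ p : Polynomial ℚ,
      (∀ t : ℕ, 1 ≤ t →
        (js (state fun i => t * μ i) (state ![t * ∑ i, μ i]) r : ℚ) = p.eval (t : ℚ)) ∧
      p.natDegree = polytopeDim (jugglingPolytope fun i => (μ i : ℝ)) ∧
      HasRelativeVolume (integralSequences r) (jugglingPolytope fun i => (μ i : ℝ))
        (ENNReal.ofReal (p.leadingCoeff : ℝ)) := by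
  obtain ⟨k, h0, h1⟩ := exists_first_nonzero μ
  have hpos : ∀ i, (0 : ℝ) ≤ μ i := fun i => Nat.cast_nonneg _
  have h0' : ∀ i : Fin r, (i : ℕ) < k → (μ i : ℝ) = 0 := fun i hi => by simp [h0 i hi]
  have h1' : ∀ i : Fin r, (i : ℕ) = k → 1 ≤ (μ i : ℝ) := fun i hi => by exact_mod_cast h1 i hi
  have hint := integralPoints_natCast μ
  obtain ⟨P, hP⟩ := (exists_mvPolynomial_ncard_coveredFlows (InnerRoot.tail (r := r) (k := k))
    InnerRoot.head InnerRoot.tail_lt_head).2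
  let p : Polynomial ℚ := MvPolynomial.aeval
    (fun s => Polynomial.C (supply μ s : ℚ) * Polynomial.X) P
  have hp : ∀ t : ℕ, ((coveredFlows (InnerRoot.tail (r := r) (k := k)) InnerRoot.head
      (supply fun i => t * μ i)).ncard : ℚ) = p.eval (t : ℚ) := by
    intro t
    rw [hP, supply_mul]
    change _ = (((Polynomial.evalRingHom (t : ℚ)).comp (MvPolynomial.aeval (R := ℚ)
      (fun s => Polynomial.C (supply μ s : ℚ) * Polynomial.X) :
        MvPolynomial (Fin (r + 1)) ℚ →ₐ[ℚ] Polynomial ℚ).toRingHom) P)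
    congr 1
    refine MvPolynomial.ringHom_ext (fun c => by simp) fun s => ?_
    simp [mul_comm]
  have hchart := hasRelativeVolume_of_chart (L := integralSequences r)
    (P := jugglingPolytope fun i => (μ i : ℝ))
    (χ := (flowToSequence fun i => (μ i : ℝ)).comp (completeFlow k fun i => (μ i : ℝ)))
    ((flowToSequence_injective _).comp (completeFlow_injective _))
    (by rw [← image_flowToSequence hpos, coe_affineSpan_image,
          affineSpan_flowPolytope hpos h0' h1', AffineMap.coe_comp, Set.range_comp])
    (by rw [← image_flowToSequence hpos, coe_affineSpan_image,
          affineSpan_flowPolytope hpos h0' h1', ← image_flowToSequence_integral_inter hint,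
          ← Set.image_univ, ← image_completeFlow_integral_inter hint, Set.image_image,
          Set.inter_univ]
        rfl)
  have hpre : ((flowToSequence fun i => (μ i : ℝ)).comp (completeFlow k fun i => (μ i : ℝ))) ⁻¹'
      (jugglingPolytope fun i => (μ i : ℝ)) = coordinatePolytope k fun i => (μ i : ℝ) := by
    rw [AffineMap.coe_comp, Set.preimage_comp, ← image_flowToSequence hpos,
      Set.preimage_image_eq _ (flowToSequence_injective _), preimage_completeFlow]
  rw [hpre] at hchart
  obtain ⟨hdeg, hvol⟩ := natDegree_eq_and_volume_eq
    (isCompact_coordinatePolytope (k := k) fun i => (μ i : ℝ)) (convex_coordinatePolytope _)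
    (interior_coordinatePolytope_nonempty hpos h1')
    (p := p) (fun t ht => by rw [ncard_coordinatePolytope_inter k μ ht, hp])
  refine ⟨p, fun t _ => ?_, hdeg.trans hchart.1.symm, hvol ▸ hchart.2⟩
  have := (finite_JS_and_js_eq (k := k) (μ := fun i => t * μ i) fun i hi => by simp [h0 i hi]).2
  rw [← Finset.mul_sum] at this
  rw [this, hp]

theorem integrallyEquivalent_flowPolytope {r : ℕ} {μ : Fin r → ℝ} (hμ : ∀ i, 0 ≤ μ i)
    (hint : μ ∈ integralPoints (Fin r)) :
    IntegrallyEquivalent (integralPoints (PosRoot r)) (flowPolytope r (weight μ))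
      (integralSequences r) (jugglingPolytope μ) := by
  refine ⟨flowToSequence μ, ?_, ?_⟩
  · rw [← image_flowToSequence hμ]
    exact (flowToSequence_injective μ).injOn.bijOn_image
  · rw [← image_flowToSequence hμ, coe_affineSpan_image, ← image_flowToSequence_integral_inter hint]
    exact (flowToSequence_injective μ).injOn.bijOn_image

theorem jugglingPolytope_eq_convexHull {r : ℕ} {μ : Fin r → ℝ} (hμ : ∀ i, 0 ≤ μ i)
    (hint : μ ∈ integralPoints (Fin r)) :
    jugglingPolytope μ =
      convexHull ℝ (flowToSequence μ '' (flowPolytope r (weight μ)).extremePoints ℝ) := by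
  rw [← AffineMap.image_convexHull, (convexHull_extremePoints_flowPolytope hμ hint).2,
    image_flowToSequence hμ]

end Juggling

end

theorem mainTheorem9 (r : ℕ) (μ : Fin r → ℕ) :
    -- the count is finite, and a polynomial in `t` whose degree and leading coefficient are the
    -- dimension and the relative volume of the juggling polytope
    (∀ t : ℕ, 1 ≤ t →
      (Juggling.JS (Juggling.state fun i => t * μ i)
        (Juggling.state ![t * ∑ i, μ i]) r).Finite) ∧
    (∃ p : Polynomial ℚ,
      (∀ t : ℕ, 1 ≤ t →
        (Juggling.js (Juggling.state fun i => t * μ i)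
          (Juggling.state ![t * ∑ i, μ i]) r : ℚ) = p.eval (t : ℚ)) ∧
      p.natDegree = Juggling.polytopeDim (Juggling.jugglingPolytope fun i => (μ i : ℝ)) ∧
      Juggling.HasRelativeVolume (Juggling.integralSequences r)
        (Juggling.jugglingPolytope fun i => (μ i : ℝ))
        (ENNReal.ofReal (p.leadingCoeff : ℝ))) ∧
    -- the juggling polytope is a polytope, integrally equivalent to the flow polytope
    Juggling.IsPolytope (Juggling.jugglingPolytope fun i => (μ i : ℝ)) ∧
    Juggling.IsPolytope (Juggling.flowPolytope r (Juggling.weight fun i => (μ i : ℝ))) ∧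
    Juggling.IntegrallyEquivalent
      (Juggling.integralPoints (Juggling.PosRoot r))
      (Juggling.flowPolytope r (Juggling.weight fun i => (μ i : ℝ)))
      (Juggling.integralSequences r)
      (Juggling.jugglingPolytope fun i => (μ i : ℝ)) ∧
    -- and their vertices are integral
    (Juggling.flowPolytope r (Juggling.weight fun i => (μ i : ℝ))).extremePoints ℝ ⊆
      Juggling.integralPoints (Juggling.PosRoot r) ∧
    (Juggling.jugglingPolytope fun i => (μ i : ℝ)).extremePoints ℝ ⊆
      Juggling.integralSequences r := by
  have hpos : ∀ i, (0 : ℝ) ≤ μ i := fun i => Nat.cast_nonneg _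
  have hint := Juggling.integralPoints_natCast μ
  have hfin := Juggling.convexHull_extremePoints_flowPolytope hpos hint
  have hhull := Juggling.jugglingPolytope_eq_convexHull hpos hint
  refine ⟨fun t _ => ?_, Juggling.exists_ehrhart_polynomial μ, ⟨_, hfin.1.image _, hhull⟩,
    ⟨_, hfin.1, hfin.2.symm⟩, Juggling.integrallyEquivalent_flowPolytope hpos hint,
    fun f hf => Juggling.integral_of_mem_extremePoints hpos hint hf, fun S hS => ?_⟩
  · rw [Finset.mul_sum]
    exact (Juggling.finite_JS_and_js_eq (k := 0) fun i hi => absurd hi (Nat.not_lt_zero _)).1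
  · rw [hhull] at hS
    -- An extreme point of a hull lies in the generating set, here the image of the vertices of the
    -- flow polytope.
    obtain ⟨f, hf, rfl⟩ := extremePoints_convexHull_subset hS
    exact Juggling.flowToSequence_integral hint
      (Juggling.integral_of_mem_extremePoints hpos hint hf)
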